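/- Let $\mathfrak g$ be a finite-dimensional semisimple Lie algebra over $\mathbb C$, let $V$ be a finite-dimensional representation of $\mathfrak g$ and let $S\subseteq V$ be a subrepresentation. Let $V_1,\dots,V_k$ be pairwise non-isomorphic irreducible finite-dimensional representations of $\mathfrak g$ and let $n_i,s_i$ be non-negative integers such that, in the representation ring $R(\mathfrak g)$ (generated additively by the classes $cl(U)$ of finite-dimensional representations, with the relations $cl(U\oplus U')=cl(U)+cl(U')$), $$cl(V)=\sum_{i=1}^k n_i\,cl(V_i),\qquad cl(S)=\sum_{i=1}^k s_i\,cl(V_i).$$ Let $Gr_{\mathfrak g}(V,S)$ be the set of all subrepresentations of $V$ that are isomorphic to $S$, regarded as a subset of the Grassmannian $Gr(\dim S,V)$ of linear subspaces of $V$ of dimension $\dim S$ (a variety through the Plücker embedding). Then $s_i\le n_i$ for all $i$, the subset $Gr_{\mathfrak g}(V,S)$ is locally closed in $Gr(\dim S,V)$ for the Zariski topology, and with the induced structure of a variety it is isomorphic to the product of ordinary Grassmannians $$Gr_{\mathfrak g}(V,S)\;\cong\;\prod_{i=1}^k Gr(n_i,s_i),$$ where $Gr(n,s)$ is the Grassmannian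 of $s$-dimensional linear subspaces of $\mathbb C^n$. The variety $Gr_{\mathfrak g}(V,S)$ is irreducible and smooth, and $$\dim Gr_{\mathfrak g}(V,S)=\sum_{i=1}^k (n_i-s_i)\,s_i .$$ -/

import Mathlib

open scoped LinearAlgebra.Projectivization Topology

universe u v w

noncomputable section

/-! ### Complex varieties as spaces with functions -/

/-- A space with functions over `ℂ`: a topological space together with, at each point `x`, a notion
of complex-valued function regular at `x`, which depends only on the germ at `x`, is an open
condition, and makes the germs of regular functions a `ℂ`-algebra in which a function not vanishing
at `x` is invertible. A function is regular on an open set if it is regular at each of its points;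
the values of a function away from the point in question are irrelevant. -/
structure FunSpace (X : Type v) where
  /-- the (Zariski) topology -/
  topology : TopologicalSpace X
  /-- `IsRegularAt f x`: the function `f` is regular at the point `x` -/
  IsRegularAt : (X → ℂ) → X → Prop
  const : ∀ (c : ℂ) (x : X), IsRegularAt (fun _ => c) x
  add : ∀ {f g : X → ℂ} {x : X}, IsRegularAt f x → IsRegularAt g x →
    IsRegularAt (fun y => f y + g y) x
  mul : ∀ {f g : X → ℂ} {x : X}, IsRegularAt f x → IsRegularAt g x →
    IsRegularAt (fun y => f y * g y) x
  inv : ∀ {f : X → ℂ} {x : X}, IsRegularAt f x → f x ≠ 0 → IsRegularAt (fun y => (f y)⁻¹) x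
  congr : ∀ {f g : X → ℂ} {x : X}, IsRegularAt f x → f =ᶠ[@nhds X topology x] g → IsRegularAt g x
  eventually : ∀ {f : X → ℂ} {x : X}, IsRegularAt f x → ∀ᶠ y in @nhds X topology x, IsRegularAt f y
  eventually_ne : ∀ {f : X → ℂ} {x : X}, IsRegularAt f x → f x ≠ 0 →
    ∀ᶠ y in @nhds X topology x, f y ≠ 0

namespace FunSpace

variable {X : Type v} {Y : Type w}

/-- The structure induced on `Y` by a map `p : Y → X` (in practice the inclusion of a subset):
the topology is induced, and a function is regular at `y` if near `y` it is the restriction of a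
function on `X` that is regular at `p y`. -/
def induced (A : FunSpace X) (p : Y → X) : FunSpace Y where
  topology := A.topology.induced p
  IsRegularAt f y := ∃ g : X → ℂ, A.IsRegularAt g (p y) ∧
    f =ᶠ[@nhds Y (A.topology.induced p) y] fun z => g (p z)
  const c y := ⟨fun _ => c, A.const c _, Filter.EventuallyEq.rfl⟩
  add := by
    rintro f g x ⟨f', hf, hf'⟩ ⟨g', hg, hg'⟩
    exact ⟨_, A.add hf hg, hf'.add hg'⟩
  mul := by
    rintro f g x ⟨f', hf, hf'⟩ ⟨g', hg, hg'⟩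
    exact ⟨_, A.mul hf hg, hf'.mul hg'⟩
  inv := by
    rintro f x ⟨f', hf, hf'⟩ h
    let _ := A.topology.induced p
    exact ⟨_, A.inv hf (by rwa [← hf'.eq_of_nhds]), hf'.inv⟩
  congr := by
    rintro f g x ⟨f', hf, hf'⟩ h
    exact ⟨f', hf, h.symm.trans hf'⟩
  eventually := by
    rintro f x ⟨f', hf, hf'⟩
    let _ := A.topology
    let _ := A.topology.induced p
    have h1 : ∀ᶠ y in 𝓝 x, A.IsRegularAt f' (p y) :=
      (continuous_induced_dom (f := p)).continuousAt.eventually (A.eventually hf)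
    filter_upwards [h1, hf'.eventuallyEq_nhds] with y h2 h3
    exact ⟨f', h2, h3⟩
  eventually_ne := by
    rintro f x ⟨f', hf, hf'⟩ h
    let _ := A.topology
    let _ := A.topology.induced p
    have h1 : ∀ᶠ y in 𝓝 x, f' (p y) ≠ 0 :=
      (continuous_induced_dom (f := p)).continuousAt.eventually
        (A.eventually_ne hf (by rwa [← hf'.eq_of_nhds]))
    filter_upwards [h1, hf'] with y h2 h3
    rwa [h3]

/-- The subspace structure on a subset. -/
def restrict (A : FunSpace X) (s : Set X) : FunSpace s := A.induced Subtype.val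

/-- The algebra of functions on `∏ i, X i` generated by the functions `x ↦ g (x i)` with `g`
regular on `U i`, that is, the image of the tensor product of the algebras of regular functions. -/
def prodAlgebra {ι : Type u} {X : ι → Type v} (A : ∀ i, FunSpace (X i)) (U : ∀ i, Set (X i)) :
    Subalgebra ℂ ((∀ i, X i) → ℂ) :=
  Algebra.adjoin ℂ {f | ∃ (i : ι) (g : X i → ℂ), (∀ y ∈ U i, (A i).IsRegularAt g y) ∧
    f = fun x => g (x i)}

lemma prodAlgebra_mono {ι : Type u} {X : ι → Type v} (A : ∀ i, FunSpace (X i))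
    {U U' : ∀ i, Set (X i)} (h : ∀ i, U' i ⊆ U i) : prodAlgebra A U ≤ prodAlgebra A U' := by
  refine Algebra.adjoin_mono ?_
  rintro f ⟨i, g, hg, rfl⟩
  exact ⟨i, g, fun y hy => hg y (h i hy), rfl⟩

/-- The Zariski topology on a finite product: a basis is given by the sets of points of a box
`∏ i, U i`, each `U i` open, where a function in the algebra `prodAlgebra A U` does not vanish.
It is finer than the product topology. -/
abbrev prodTopology {ι : Type u} {X : ι → Type v} (A : ∀ i, FunSpace (X i)) :
    TopologicalSpace (∀ i, X i) :=
  TopologicalSpace.generateFrom {W | ∃ U : ∀ i, Set (X i), (∀ i, (A i).topology.IsOpen (U i)) ∧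
    ∃ b ∈ prodAlgebra A U, W = {x | (∀ i, x i ∈ U i) ∧ b x ≠ 0}}

lemma prodTopology_mem_nhds {ι : Type u} {X : ι → Type v} (A : ∀ i, FunSpace (X i))
    {U : ∀ i, Set (X i)} (hU : ∀ i, (A i).topology.IsOpen (U i)) {b : (∀ i, X i) → ℂ}
    (hb : b ∈ prodAlgebra A U) {x : ∀ i, X i} (hx : ∀ i, x i ∈ U i) (hbx : b x ≠ 0) :
    {y | (∀ i, y i ∈ U i) ∧ b y ≠ 0} ∈ @nhds _ (prodTopology A) x := by
  let _ := prodTopology A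
  exact IsOpen.mem_nhds
    (TopologicalSpace.isOpen_generateFrom_of_mem ⟨U, hU, b, hb, rfl⟩) ⟨hx, hbx⟩

/-- The product of finitely many spaces with functions: a function is regular at `x` if near `x` it
is a quotient `a / b` with `a`, `b` in the algebra generated by the regular functions on the factors
of a box around `x` and `b x ≠ 0`. -/
def prod {ι : Type u} {X : ι → Type v} (A : ∀ i, FunSpace (X i)) : FunSpace (∀ i, X i) where
  topology := prodTopology A
  IsRegularAt f x := ∃ U : ∀ i, Set (X i), (∀ i, (A i).topology.IsOpen (U i)) ∧ (∀ i, x i ∈ U i) ∧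
    ∃ a ∈ prodAlgebra A U, ∃ b ∈ prodAlgebra A U, b x ≠ 0 ∧
      f =ᶠ[@nhds _ (prodTopology A) x] fun y => a y / b y
  const c x := ⟨fun _ => Set.univ, fun i => (A i).topology.isOpen_univ, fun _ => trivial,
    algebraMap ℂ _ c, Subalgebra.algebraMap_mem _ c, 1, one_mem _, by simp,
    Filter.Eventually.of_forall fun y => by simp⟩
  add := by
    rintro f g x ⟨U, hU, hx, a, ha, b, hb, hbx, hf⟩ ⟨U', hU', hx', a', ha', b', hb', hbx', hg⟩
    have l := prodAlgebra_mono A (U := U) (U' := fun i => U i ∩ U' i)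
      fun i => Set.inter_subset_left
    have r := prodAlgebra_mono A (U := U') (U' := fun i => U i ∩ U' i)
      fun i => Set.inter_subset_right
    refine ⟨fun i => U i ∩ U' i, fun i => (A i).topology.isOpen_inter _ _ (hU i) (hU' i),
      fun i => ⟨hx i, hx' i⟩, a * b' + b * a', add_mem (mul_mem (l ha) (r hb'))
        (mul_mem (l hb) (r ha')), b * b', mul_mem (l hb) (r hb'), mul_ne_zero hbx hbx', ?_⟩
    filter_upwards [hf, hg, prodTopology_mem_nhds A hU hb hx hbx,
      prodTopology_mem_nhds A hU' hb' hx' hbx'] with y h1 h2 h3 h4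
    simp only [Pi.add_apply, Pi.mul_apply]
    rw [h1, h2, div_add_div _ _ h3.2 h4.2]
  mul := by
    rintro f g x ⟨U, hU, hx, a, ha, b, hb, hbx, hf⟩ ⟨U', hU', hx', a', ha', b', hb', hbx', hg⟩
    have l := prodAlgebra_mono A (U := U) (U' := fun i => U i ∩ U' i)
      fun i => Set.inter_subset_left
    have r := prodAlgebra_mono A (U := U') (U' := fun i => U i ∩ U' i)
      fun i => Set.inter_subset_right
    refine ⟨fun i => U i ∩ U' i, fun i => (A i).topology.isOpen_inter _ _ (hU i) (hU' i),
      fun i => ⟨hx i, hx' i⟩, a * a', mul_mem (l ha) (r ha'), b * b', mul_mem (l hb) (r hb'),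
      mul_ne_zero hbx hbx', ?_⟩
    filter_upwards [hf, hg] with y h1 h2
    simp only [Pi.mul_apply]
    rw [h1, h2, div_mul_div_comm]
  inv := by
    rintro f x ⟨U, hU, hx, a, ha, b, hb, hbx, hf⟩ h
    let _ := prodTopology A
    have hax : a x ≠ 0 := by
      intro h0
      apply h
      rw [hf.eq_of_nhds, h0, zero_div]
    refine ⟨U, hU, hx, b, hb, a, ha, hax, ?_⟩
    filter_upwards [hf] with y h1
    rw [h1, inv_div]
  congr := by
    rintro f g x ⟨U, hU, hx, a, ha, b, hb, hbx, hf⟩ h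
    exact ⟨U, hU, hx, a, ha, b, hb, hbx, h.symm.trans hf⟩
  eventually := by
    rintro f x ⟨U, hU, hx, a, ha, b, hb, hbx, hf⟩
    let _ := prodTopology A
    filter_upwards [hf.eventuallyEq_nhds, prodTopology_mem_nhds A hU hb hx hbx] with y h1 h2
    exact ⟨U, hU, h2.1, a, ha, b, hb, h2.2, h1⟩
  eventually_ne := by
    rintro f x ⟨U, hU, hx, a, ha, b, hb, hbx, hf⟩ h
    let _ := prodTopology A
    have hax : a x ≠ 0 := by
      intro h0
      apply h
      rw [hf.eq_of_nhds, h0, zero_div]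
    filter_upwards [hf, prodTopology_mem_nhds A hU hb hx hbx,
      prodTopology_mem_nhds A hU ha hx hax] with y h1 h2 h3
    rw [h1]
    exact div_ne_zero h3.2 h2.2

/-- Isomorphism of spaces with functions: a homeomorphism that identifies the regular functions. -/
def Isomorphic (A : FunSpace X) (B : FunSpace Y) : Prop :=
  ∃ e : X ≃ Y, (∀ U : Set Y, A.topology.IsOpen (e ⁻¹' U) ↔ B.topology.IsOpen U) ∧
    ∀ (f : Y → ℂ) (x : X), A.IsRegularAt (fun z => f (e z)) x ↔ B.IsRegularAt f (e x)

/-- The space is irreducible (in particular not empty). -/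
def Irreducible (A : FunSpace X) : Prop := @IrreducibleSpace X A.topology

/-- The dimension: the supremum of the lengths of chains of irreducible closed subsets. -/
def dim (A : FunSpace X) : WithBot ℕ∞ := @topologicalKrullDim X A.topology

/-- The local ring at `x`: the ring of germs at `x` of functions that are regular at `x`. -/
def localRing (A : FunSpace X) (x : X) : Subring ((@nhds X A.topology x).Germ ℂ) where
  carrier := {γ | ∃ f : X → ℂ, A.IsRegularAt f x ∧ γ = (f : (@nhds X A.topology x).Germ ℂ)}
  mul_mem' := by
    rintro _ _ ⟨f, hf, rfl⟩ ⟨g, hg, rfl⟩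
    exact ⟨_, A.mul hf hg, rfl⟩
  one_mem' := ⟨_, A.const 1 x, rfl⟩
  add_mem' := by
    rintro _ _ ⟨f, hf, rfl⟩ ⟨g, hg, rfl⟩
    exact ⟨_, A.add hf hg, rfl⟩
  zero_mem' := ⟨_, A.const 0 x, rfl⟩
  neg_mem' := by
    rintro _ ⟨f, hf, rfl⟩
    refine ⟨_, A.mul (A.const (-1) x) hf, ?_⟩
    rw [← Filter.Germ.coe_neg]
    congr 1
    funext y
    simp

/-- Smoothness: every local ring is a regular local ring. -/
def Smooth (A : FunSpace X) : Prop := ∀ x : X, IsRegularLocalRing (A.localRing x)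

end FunSpace

/-! ### Projective space -/

section ProjectiveSpace

variable {W : Type v} [AddCommGroup W] [Module ℂ W]

/-- The value at a vector `x` of a polynomial expression in linear forms. -/
def evalForm (F : MvPolynomial (Module.Dual ℂ W) ℂ) (x : W) : ℂ :=
  MvPolynomial.eval (fun φ : Module.Dual ℂ W => φ x) F

variable (W) in
/-- The Zariski topology on `ℙ(W)`: a basis is given by the non-vanishing loci of homogeneous
polynomials. -/
abbrev projTopology : TopologicalSpace (ℙ ℂ W) :=
  TopologicalSpace.generateFrom {s | ∃ (d : ℕ) (F : MvPolynomial (Module.Dual ℂ W) ℂ),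
    F.IsHomogeneous d ∧ s = {x | evalForm F x.rep ≠ 0}}

lemma projTopology_mem_nhds {d : ℕ} {F : MvPolynomial (Module.Dual ℂ W) ℂ}
    (hF : F.IsHomogeneous d) {x : ℙ ℂ W} (hx : evalForm F x.rep ≠ 0) :
    {y : ℙ ℂ W | evalForm F y.rep ≠ 0} ∈ @nhds _ (projTopology W) x := by
  let _ := projTopology W
  exact IsOpen.mem_nhds
    (TopologicalSpace.isOpen_generateFrom_of_mem ⟨d, F, hF, rfl⟩) hx

variable (W) in
/-- The projective space `ℙ(W)`: a function is regular at `x` if near `x` it is a quotient `F / G`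
of homogeneous polynomials of the same degree with `G x ≠ 0`. -/
def projSpace : FunSpace (ℙ ℂ W) where
  topology := projTopology W
  IsRegularAt f x := ∃ (d : ℕ) (F G : MvPolynomial (Module.Dual ℂ W) ℂ),
    F.IsHomogeneous d ∧ G.IsHomogeneous d ∧ evalForm G x.rep ≠ 0 ∧
      f =ᶠ[@nhds _ (projTopology W) x] fun y => evalForm F y.rep / evalForm G y.rep
  const c x := ⟨0, MvPolynomial.C c, 1, MvPolynomial.isHomogeneous_C _ c,
    MvPolynomial.isHomogeneous_one _ _, by simp [evalForm],
    Filter.Eventually.of_forall fun y => by simp [evalForm]⟩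
  add := by
    rintro f g x ⟨d, F, G, hF, hG, hx, hf⟩ ⟨d', F', G', hF', hG', hx', hg⟩
    refine ⟨d + d', F * G' + G * F', G * G', (hF.mul hG').add (hG.mul hF'), hG.mul hG',
      by simpa [evalForm] using And.intro hx hx', ?_⟩
    filter_upwards [hf, hg, projTopology_mem_nhds hG hx, projTopology_mem_nhds hG' hx'] with
      y h1 h2 h3 h4
    rw [h1, h2, div_add_div _ _ h3 h4]
    simp [evalForm]
  mul := by
    rintro f g x ⟨d, F, G, hF, hG, hx, hf⟩ ⟨d', F', G', hF', hG', hx', hg⟩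
    refine ⟨d + d', F * F', G * G', hF.mul hF', hG.mul hG',
      by simpa [evalForm] using And.intro hx hx', ?_⟩
    filter_upwards [hf, hg] with y h1 h2
    rw [h1, h2, div_mul_div_comm]
    simp [evalForm]
  inv := by
    rintro f x ⟨d, F, G, hF, hG, hx, hf⟩ h
    let _ := projTopology W
    have hFx : evalForm F x.rep ≠ 0 := by
      intro h0
      apply h
      rw [hf.eq_of_nhds, h0, zero_div]
    refine ⟨d, G, F, hG, hF, hFx, ?_⟩
    filter_upwards [hf] with y h1
    rw [h1, inv_div]
  congr := by
    rintro f g x ⟨d, F, G, hF, hG, hx, hf⟩ h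
    exact ⟨d, F, G, hF, hG, hx, h.symm.trans hf⟩
  eventually := by
    rintro f x ⟨d, F, G, hF, hG, hx, hf⟩
    let _ := projTopology W
    filter_upwards [hf.eventuallyEq_nhds, projTopology_mem_nhds hG hx] with y h1 h2
    exact ⟨d, F, G, hF, hG, h2, h1⟩
  eventually_ne := by
    rintro f x ⟨d, F, G, hF, hG, hx, hf⟩ h
    let _ := projTopology W
    have hFx : evalForm F x.rep ≠ 0 := by
      intro h0
      apply h
      rw [hf.eq_of_nhds, h0, zero_div]
    filter_upwards [hf, projTopology_mem_nhds hG hx, projTopology_mem_nhds hF hFx] with y h1 h2 h3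
    rw [h1]
    exact div_ne_zero h3 h2

end ProjectiveSpace

/-! ### Grassmannians -/

section Grassmannian

variable (V : Type v) [AddCommGroup V] [Module ℂ V]

/-- The set of `d`-dimensional linear subspaces of `V`. -/
def Gr (d : ℕ) : Type v := {U : Submodule ℂ V // Module.finrank ℂ U = d}

variable {V}

lemma ιMulti_ne_zero_of_linearIndependent {d : ℕ} {b : Fin d → V} (hb : LinearIndependent ℂ b) :
    exteriorPower.ιMulti ℂ d b ≠ 0 := by
  have h := (exteriorPower.ιMulti_family_linearIndependent_field (n := d) hb).ne_zero
    (Set.powersetCard.ofFinEmbEquiv (RelEmbedding.refl (· ≤ ·)))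
  rw [exteriorPower.ιMulti_family, Equiv.symm_apply_apply] at h
  exact h

variable [FiniteDimensional ℂ V]

/-- The Plücker embedding: it sends the subspace with basis `b 0, …, b (d - 1)` to the line spanned
by `b 0 ∧ ⋯ ∧ b (d - 1)`. -/
def plucker {d : ℕ} (U : Gr V d) : ℙ ℂ (⋀[ℂ]^d V) :=
  Projectivization.mk ℂ
    (exteriorPower.ιMulti ℂ d fun i => (Module.finBasisOfFinrankEq ℂ U.1 U.2 i : V))
    (ιMulti_ne_zero_of_linearIndependent
      ((Module.finBasisOfFinrankEq ℂ U.1 U.2).linearIndependent.map' U.1.subtype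
        (Submodule.ker_subtype _)))

variable (V) in
/-- The Grassmannian of `d`-dimensional subspaces of `V`, with the structure of a variety that it
gets from the Plücker embedding. -/
def grassmannian (d : ℕ) : FunSpace (Gr V d) := (projSpace (⋀[ℂ]^d V)).induced plucker

end Grassmannian

/-! ### Representations -/

section Representations

variable (𝔤 : Type u) [LieRing 𝔤] [LieAlgebra ℂ 𝔤]

/-- A finite dimensional representation of `𝔤`. -/
structure LieRep where
  /-- the underlying space -/
  carrier : Type w
  [addCommGroup : AddCommGroup carrier]
  [module : Module ℂ carrier]
  [lieRingModule : LieRingModule 𝔤 carrier]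
  [lieModule : LieModule ℂ 𝔤 carrier]
  [finiteDimensional : FiniteDimensional ℂ carrier]

attribute [instance] LieRep.addCommGroup LieRep.module LieRep.lieRingModule LieRep.lieModule
  LieRep.finiteDimensional

/-- The relations of the representation ring: `[V] - ([W] + [U])` whenever `V ≅ W ⊕ U`. -/
def repRelations : AddSubgroup (FreeAbelianGroup (LieRep.{u, w} 𝔤)) :=
  AddSubgroup.closure {x | ∃ (V W U : LieRep.{u, w} 𝔤) (i : W.carrier →ₗ⁅ℂ,𝔤⁆ V.carrier)
    (j : U.carrier →ₗ⁅ℂ,𝔤⁆ V.carrier),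
    Function.Bijective (fun p : W.carrier × U.carrier => i p.1 + j p.2) ∧
    x = FreeAbelianGroup.of V - (FreeAbelianGroup.of W + FreeAbelianGroup.of U)}

/-- The additive group of the representation ring `R(𝔤)` of finite dimensional representations. -/
abbrev RepRing : Type (max u (w + 1)) :=
  FreeAbelianGroup (LieRep.{u, w} 𝔤) ⧸ repRelations.{u, w} 𝔤

/-- The class of a finite dimensional representation in `R(𝔤)`. -/
def cl (V : Type w) [AddCommGroup V] [Module ℂ V] [LieRingModule 𝔤 V] [LieModule ℂ 𝔤 V]
    [FiniteDimensional ℂ V] : RepRing.{u, w} 𝔤 :=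
  QuotientAddGroup.mk (FreeAbelianGroup.of (LieRep.mk V))

variable {𝔤} {V : Type w} [AddCommGroup V] [Module ℂ V] [LieRingModule 𝔤 V] [LieModule ℂ 𝔤 V]
  [FiniteDimensional ℂ V]

/-- The set of subrepresentations of `V` isomorphic to `S`, as a subset of the Grassmannian of
subspaces of `V` of dimension `dim S`. -/
def lieGrSet (S : LieSubmodule ℂ 𝔤 V) : Set (Gr V (Module.finrank ℂ S)) :=
  {U | ∃ N : LieSubmodule ℂ 𝔤 V, N.toSubmodule = U.1 ∧ Nonempty (N ≃ₗ⁅ℂ,𝔤⁆ S)}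

/-- The `𝔤`-Grassmannian `Gr_𝔤(V, S)`, as a subspace of the Grassmannian. -/
def lieGrassmannian (S : LieSubmodule ℂ 𝔤 V) : FunSpace (lieGrSet S) :=
  (grassmannian V (Module.finrank ℂ S)).restrict (lieGrSet S)

end Representations

end

open scoped LinearAlgebra.Projectivization Topology

noncomputable section

namespace FunSpace

/-! ### Open immersions of spaces with functions, and properties that are checked on charts. -/

section Charts

variable {X Y E : Type*}

/-! Bases of the spaces Hom(W_i, V) identify V with ⨁ ℂ^{n_i} ⊗ W_i, the Lie algebra acting on the
factors W_i. By Schur's lemma the subrepresentations N isomorphic to S are exactly the ⨁ P_i ⊗ W_i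
with P_i ⊆ ℂ^{n_i} of dimension s_i, where P_i = Hom(W_i, N). This is the bijection `grEquiv`, and
it gives s_i ≤ n_i.

The decomposition comes from a dimension count. The numbers dim V and dim Hom(M, V) are additive on
direct sums, so they factor through R(𝔤). The class equation and Schur's lemma then give dim
Hom(W_i, V) = n_i and dim V = ∑ n_i dim W_i. Linearly independent morphisms W_i → V embed the direct
sum of their sources (`eq_zero_of_sum_irreducible_eq_zero`), and equality of dimensions makes the
embedding surjective. The same argument applies to every N isomorphic to S.

The geometry is read off in charts. For V = A ⊕ B, the graphs of linear maps A → B form an open part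
of the Grassmannian isomorphic to the affine space Hom(A, B) (`isChart_graphGr`). If Q_i is a
complement of P_i, then ⨁ Q_i ⊗ W_i is a complement of ⨁ P_i ⊗ W_i, and the graphs of maps f_i : P_i
→ Q_i assemble into the graph of ⨁ f_i ⊗ id (`sub_graph`). Inside such a chart the Lie Grassmannian
is therefore the linear subspace ∏ Hom(P_i, Q_i), which is closed, and this same affine space is a
chart of ∏ Gr(n_i, s_i) (`isChart_pi`). Local closedness and the isomorphism follow.

Smoothness and dimension are local and reduce to affine space, where they follow from regularity of
polynomial rings and from the Nullstellensatz. For irreducibility, any two points lie in a common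
chart, because subspaces of equal dimension have a common complement. -/

lemma ext_iff_regular {A B : FunSpace X} (ht : A.topology = B.topology)
    (hr : ∀ f x, A.IsRegularAt f x ↔ B.IsRegularAt f x) : A = B := by
  have : A.IsRegularAt = B.IsRegularAt := by
    funext f x
    exact propext (hr f x)
  cases A
  cases B
  dsimp only at ht this
  subst ht
  subst this
  rfl

lemma induced_induced (A : FunSpace X) (p : Y → X) (q : E → Y) :
    (A.induced p).induced q = A.induced (p ∘ q) := by
  have ht : ((A.induced p).induced q).topology = (A.induced (p ∘ q)).topology := induced_compose
  refine ext_iff_regular ht fun f x => ?_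
  constructor
  · rintro ⟨g, ⟨h, hh, hgh⟩, hfg⟩
    refine ⟨h, hh, ?_⟩
    have hfg' : f =ᶠ[@nhds E (A.induced (p ∘ q)).topology x] fun z => g (q z) := by
      rw [← ht]; exact hfg
    refine hfg'.trans ?_
    let _ := A.topology
    let _ := A.topology.induced p
    let _ := (A.induced (p ∘ q)).topology
    have hc : Continuous q := by
      rw [continuous_iff_le_induced]
      exact ht.ge
    exact hc.continuousAt.eventually hgh
  · rintro ⟨h, hh, hf⟩
    refine ⟨fun y => h (p y), ⟨h, hh, Filter.EventuallyEq.rfl⟩, ?_⟩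
    change f =ᶠ[@nhds E ((A.induced p).induced q).topology x] _
    rw [ht]
    exact hf

/-- An open immersion `φ : E → X` which identifies the space with functions `B` with an open
subspace of `A`. -/
structure IsChart (A : FunSpace X) (B : FunSpace E) (φ : E → X) : Prop where
  injective : Function.Injective φ
  isOpen_range : A.topology.IsOpen (Set.range φ)
  induced_eq : A.induced φ = B

namespace IsChart

variable {A : FunSpace X} {B : FunSpace E} {φ : E → X}

lemma isOpenEmbedding (h : IsChart A B φ) :
    @Topology.IsOpenEmbedding E X B.topology A.topology φ := by
  let _ := A.topology
  let _ := B.topology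
  refine ⟨⟨⟨?_⟩, h.injective⟩, h.isOpen_range⟩
  rw [← h.induced_eq]
  rfl

lemma map_nhds (h : IsChart A B φ) (x : E) :
    Filter.map φ (@nhds E B.topology x) = @nhds X A.topology (φ x) := by
  let _ := A.topology
  let _ := B.topology
  exact h.isOpenEmbedding.map_nhds_eq x

/-- Since the range is open, neighbourhoods of x and of φ x correspond, so an equality of germs on E
is an equality of germs on X. -/
lemma isRegularAt_iff (h : IsChart A B φ) (f : X → ℂ) (x : E) :
    B.IsRegularAt (fun z => f (φ z)) x ↔ A.IsRegularAt f (φ x) := by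
  have hm := h.map_nhds x
  constructor
  · intro hf
    rw [← h.induced_eq] at hf
    obtain ⟨g, hg, hfg⟩ := hf
    refine A.congr hg ?_
    change _ =ᶠ[@nhds E (A.induced φ).topology x] _ at hfg
    rw [h.induced_eq] at hfg
    rw [← hm]
    exact Filter.eventually_map.2 hfg.symm
  · intro hf
    rw [← h.induced_eq]
    exact ⟨f, hf, Filter.EventuallyEq.rfl⟩

lemma isRegularAt_extend (h : IsChart A B φ) {f : E → ℂ} {x : E} (hf : B.IsRegularAt f x)
    (c : X → ℂ) : A.IsRegularAt (Function.extend φ f c) (φ x) := by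
  rw [← h.isRegularAt_iff]
  simpa only [h.injective.extend_apply] using hf

end IsChart

/-- The homomorphism of rings of germs given by composition with a map. -/
def germComp {α β : Type*} {l : Filter α} {l' : Filter β} (φ : α → β)
    (h : Filter.Tendsto φ l l') : l'.Germ ℂ →+* l.Germ ℂ where
  toFun γ := γ.compTendsto φ h
  map_one' := rfl
  map_zero' := rfl
  map_mul' a b := by
    induction a using Filter.Germ.inductionOn
    induction b using Filter.Germ.inductionOn
    rfl
  map_add' a b := by
    induction a using Filter.Germ.inductionOn
    induction b using Filter.Germ.inductionOn
    rfl

lemma germComp_injective {α β : Type*} {l : Filter α} {l' : Filter β} {φ : α → β}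
    (h : Filter.Tendsto φ l l') (h' : l' ≤ Filter.map φ l) :
    Function.Injective (germComp φ h) := by
  intro a b hab
  induction a using Filter.Germ.inductionOn with | _ f =>
  induction b using Filter.Germ.inductionOn with | _ g =>
  have h1 : (fun x => f (φ x)) =ᶠ[l] fun x => g (φ x) := Filter.Germ.coe_eq.1 hab
  exact Filter.Germ.coe_eq.2 (h' h1)

/-- An open immersion induces an isomorphism of local rings. -/
lemma IsChart.nonempty_localRing_equiv {A : FunSpace X} {B : FunSpace E} {φ : E → X}
    (h : IsChart A B φ) (x : E) : Nonempty (B.localRing x ≃+* A.localRing (φ x)) := by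
  have hm := h.map_nhds x
  let F := germComp φ (hm.le : Filter.Tendsto φ _ _)
  have hF : ∀ γ : A.localRing (φ x), F γ ∈ B.localRing x := by
    rintro ⟨_, f, hf, rfl⟩
    exact ⟨fun z => f (φ z), (h.isRegularAt_iff f x).2 hf, rfl⟩
  let G : A.localRing (φ x) →+* B.localRing x :=
    (F.comp (A.localRing (φ x)).subtype).codRestrict _ hF
  refine ⟨(RingEquiv.ofBijective G ⟨?_, ?_⟩).symm⟩
  · intro a b hab
    exact Subtype.ext (germComp_injective hm.le hm.ge (congrArg Subtype.val hab))
  · rintro ⟨_, f, hf, rfl⟩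
    refine ⟨⟨_, Function.extend φ f 0, h.isRegularAt_extend hf 0, rfl⟩, Subtype.ext ?_⟩
    exact Filter.Germ.coe_eq.2 (Filter.Eventually.of_forall fun z => h.injective.extend_apply f 0 z)

/-- A bijection that locally is an isomorphism is an isomorphism. -/
lemma isomorphic_of_charts {A : FunSpace X} {B : FunSpace Y} (e : X ≃ Y)
    (h : ∀ x, ∃ (E : Type w) (C : FunSpace E) (φ : E → X), IsChart A C φ ∧
      IsChart B C (fun z => e (φ z)) ∧ x ∈ Set.range φ) : A.Isomorphic B := by
  have hn : ∀ x, Filter.map e (@nhds X A.topology x) = @nhds Y B.topology (e x) := by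
    intro x
    obtain ⟨E, C, φ, h1, h2, c, rfl⟩ := h x
    rw [← h1.map_nhds, ← h2.map_nhds, Filter.map_map]
    rfl
  refine ⟨e, fun U => ?_, fun f x => ?_⟩
  · let _ := A.topology
    let _ := B.topology
    change IsOpen _ ↔ IsOpen _
    rw [isOpen_iff_mem_nhds, isOpen_iff_mem_nhds, ← e.forall_congr_right (q := fun y => y ∈ U → _)]
    refine forall_congr' fun x => ?_
    rw [← hn x]
    rfl
  · obtain ⟨E, C, φ, h1, h2, c, rfl⟩ := h x
    rw [← h1.isRegularAt_iff, ← h2.isRegularAt_iff]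

lemma smooth_of_charts {A : FunSpace X}
    (h : ∀ x, ∃ (E : Type w) (C : FunSpace E) (φ : E → X), IsChart A C φ ∧ C.Smooth ∧
      x ∈ Set.range φ) : A.Smooth := by
  intro x
  obtain ⟨E, C, φ, h1, h2, c, rfl⟩ := h x
  obtain ⟨e⟩ := h1.nonempty_localRing_equiv c
  have := h2 c
  exact IsRegularLocalRing.of_ringEquiv e

/-- The dimension is the supremum of the coheights of irreducible closed sets. Such a set meeting a
chart has the coheight of its trace there, because every larger irreducible closed set meets the
chart too. Conversely, a subspace has at most the dimension of the whole space. -/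
lemma dim_of_charts {A : FunSpace X} [Nonempty X] {d : WithBot ℕ∞}
    (h : ∀ x, ∃ (E : Type w) (C : FunSpace E) (φ : E → X), IsChart A C φ ∧ C.dim = d ∧
      x ∈ Set.range φ) : A.dim = d := by
  let _ := A.topology
  apply le_antisymm
  · change Order.krullDim _ ≤ _
    rw [Order.krullDim_eq_iSup_coheight]
    refine iSup_le fun Z => ?_
    obtain ⟨x, hx⟩ := Z.2.nonempty
    obtain ⟨E, C, φ, h1, h2, c, rfl⟩ := h x
    let _ := C.topology
    have ho := h1.isOpenEmbedding
    obtain ⟨T, hT⟩ :=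
      (TopologicalSpace.IrreducibleCloseds.orderIsoOfIsOpenEmbedding φ ho).surjective ⟨Z, c, hx⟩
    have hT' : TopologicalSpace.IrreducibleCloseds.map φ ho.continuous T = Z :=
      congrArg Subtype.val hT
    rw [← hT', ho.coheight_map, ← h2]
    exact Order.coheight_le_krullDim T
  · obtain ⟨E, C, φ, h1, h2, -⟩ := h (Classical.arbitrary X)
    let _ := C.topology
    rw [← h2]
    exact h1.isOpenEmbedding.toIsInducing.topologicalKrullDim_le

/-- Irreducibility is not local, so the charts must overlap: each y needs an irreducible open
neighbourhood U meeting the chart at x. If O₁ contains x and O₂ contains y, irreducibility of the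
chart makes O₁ meet U, and irreducibility of U then makes O₁ meet O₂. -/
lemma irreducible_of_charts {A : FunSpace X} [Nonempty X]
    (h : ∀ x, ∃ (E : Type w) (C : FunSpace E) (φ : E → X), IsChart A C φ ∧ C.Irreducible ∧
      x ∈ Set.range φ ∧ ∀ y, ∃ U : Set X, A.topology.IsOpen U ∧ y ∈ U ∧
        @IsPreirreducible X A.topology U ∧ (U ∩ Set.range φ).Nonempty) : A.Irreducible := by
  let _ := A.topology
  have hp : PreirreducibleSpace X := by
    refine ⟨?_⟩
    rintro O₁ O₂ h₁ h₂ ⟨x, -, hx⟩ ⟨y, -, hy⟩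
    obtain ⟨E, C, φ, h1, h2, hxφ, h3⟩ := h x
    obtain ⟨U, hU, hyU, hirr, hne⟩ := h3 y
    let _ := C.topology
    have : IrreducibleSpace E := h2
    have ho := h1.isOpenEmbedding
    have hφ : IsPreirreducible (Set.range φ) := by
      rw [← Set.image_univ]
      exact (IrreducibleSpace.isIrreducible_univ E).2.image φ ho.continuous.continuousOn
    obtain ⟨z, hz, hz1, hz2⟩ := hφ O₁ U h₁ hU ⟨x, hxφ, hx⟩ (by rwa [Set.inter_comm])
    obtain ⟨t, -, ht⟩ := hirr O₁ O₂ h₁ h₂ ⟨z, hz2, hz1⟩ ⟨y, hyU, hy⟩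
    exact ⟨t, trivial, ht⟩
  exact { hp with toNonempty := ‹_› }

end Charts

/-! ### Spaces with functions defined by an algebra of functions. -/

section Algebra

variable {X Y : Type*}

lemma nonvanishing_mem_nhds (R : Subalgebra ℂ (X → ℂ)) {p : X → ℂ} (hp : p ∈ R) {x : X}
    (hx : p x ≠ 0) :
    {y | p y ≠ 0} ∈ @nhds _ (.generateFrom {s | ∃ p ∈ R, s = {x : X | p x ≠ 0}}) x := by
  let _ := TopologicalSpace.generateFrom {s | ∃ p ∈ R, s = {x : X | p x ≠ 0}}
  exact IsOpen.mem_nhds (TopologicalSpace.isOpen_generateFrom_of_mem ⟨p, hp, rfl⟩) hx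

/-- The space with functions given by an algebra `R` of functions: the topology has as basis the
nonvanishing loci of elements of `R`, and the regular functions are locally quotients of elements
of `R`. -/
def ofAlgebra (R : Subalgebra ℂ (X → ℂ)) : FunSpace X where
  topology := TopologicalSpace.generateFrom {s | ∃ p ∈ R, s = {x | p x ≠ 0}}
  IsRegularAt f x := ∃ p ∈ R, ∃ q ∈ R, q x ≠ 0 ∧
    f =ᶠ[@nhds _ (.generateFrom {s | ∃ p ∈ R, s = {x | p x ≠ 0}}) x] fun y => p y / q y
  const c x := ⟨algebraMap ℂ _ c, Subalgebra.algebraMap_mem _ c, 1, one_mem _, by simp,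
    Filter.Eventually.of_forall fun y => by simp⟩
  add := by
    rintro f g x ⟨p, hp, q, hq, hx, hf⟩ ⟨p', hp', q', hq', hx', hg⟩
    let _ := TopologicalSpace.generateFrom {s | ∃ p ∈ R, s = {x : X | p x ≠ 0}}
    refine ⟨p * q' + q * p', add_mem (mul_mem hp hq') (mul_mem hq hp'), q * q', mul_mem hq hq',
      mul_ne_zero hx hx', ?_⟩
    filter_upwards [hf, hg,
      nonvanishing_mem_nhds R hq hx,
      nonvanishing_mem_nhds R hq' hx']
      with y h1 h2 h3 h4
    rw [h1, h2, div_add_div _ _ h3 h4]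
    rfl
  mul := by
    rintro f g x ⟨p, hp, q, hq, hx, hf⟩ ⟨p', hp', q', hq', hx', hg⟩
    refine ⟨p * p', mul_mem hp hp', q * q', mul_mem hq hq', mul_ne_zero hx hx', ?_⟩
    filter_upwards [hf, hg] with y h1 h2
    rw [h1, h2, div_mul_div_comm]
    rfl
  inv := by
    rintro f x ⟨p, hp, q, hq, hx, hf⟩ h
    let _ := TopologicalSpace.generateFrom {s | ∃ p ∈ R, s = {x : X | p x ≠ 0}}
    have hpx : p x ≠ 0 := by
      intro h0
      apply h
      rw [hf.eq_of_nhds, h0, zero_div]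
    refine ⟨q, hq, p, hp, hpx, ?_⟩
    filter_upwards [hf] with y h1
    rw [h1, inv_div]
  congr := by
    rintro f g x ⟨p, hp, q, hq, hx, hf⟩ h
    exact ⟨p, hp, q, hq, hx, h.symm.trans hf⟩
  eventually := by
    rintro f x ⟨p, hp, q, hq, hx, hf⟩
    let _ := TopologicalSpace.generateFrom {s | ∃ p ∈ R, s = {x : X | p x ≠ 0}}
    filter_upwards [hf.eventuallyEq_nhds,
      nonvanishing_mem_nhds R hq hx]
      with y h1 h2
    exact ⟨p, hp, q, hq, h2, h1⟩
  eventually_ne := by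
    rintro f x ⟨p, hp, q, hq, hx, hf⟩ h
    let _ := TopologicalSpace.generateFrom {s | ∃ p ∈ R, s = {x : X | p x ≠ 0}}
    have hpx : p x ≠ 0 := by
      intro h0
      apply h
      rw [hf.eq_of_nhds, h0, zero_div]
    filter_upwards [hf,
      nonvanishing_mem_nhds R hq hx,
      nonvanishing_mem_nhds R hp hpx]
      with y h1 h2 h3
    rw [h1]
    exact div_ne_zero h3 h2

lemma isOpen_ofAlgebra {R : Subalgebra ℂ (X → ℂ)} {p : X → ℂ} (hp : p ∈ R) :
    (ofAlgebra R).topology.IsOpen {x | p x ≠ 0} :=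
  TopologicalSpace.isOpen_generateFrom_of_mem ⟨p, hp, rfl⟩

lemma isRegularAt_ofAlgebra {R : Subalgebra ℂ (X → ℂ)} {p : X → ℂ} (hp : p ∈ R) (x : X) :
    (ofAlgebra R).IsRegularAt p x :=
  ⟨p, hp, 1, one_mem _, one_ne_zero, Filter.Eventually.of_forall fun y => by simp⟩

lemma isTopologicalBasis_ofAlgebra (R : Subalgebra ℂ (X → ℂ)) :
    @TopologicalSpace.IsTopologicalBasis X (ofAlgebra R).topology
      {s | ∃ p ∈ R, s = {x | p x ≠ 0}} := by
  let _ := (ofAlgebra R).topology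
  have h := TopologicalSpace.isTopologicalBasis_of_subbasis_of_inter
    (r := {s | ∃ p ∈ R, s = {x : X | p x ≠ 0}}) rfl (by
      rintro _ ⟨p, hp, rfl⟩ _ ⟨q, hq, rfl⟩
      refine ⟨p * q, mul_mem hp hq, ?_⟩
      ext x
      simp)
  -- The whole space, added to the family by the general criterion, is already the nonvanishing
  -- locus of 1.
  rwa [Set.insert_eq_of_mem] at h
  exact ⟨1, one_mem _, by simp⟩

/-- Topology and regular functions are both expressed through the algebra alone, so it suffices that
pullback along φ maps R onto R'. -/
lemma induced_ofAlgebra {R : Subalgebra ℂ (X → ℂ)} {R' : Subalgebra ℂ (Y → ℂ)} (φ : Y → X)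
    (h₁ : ∀ p ∈ R, (fun y => p (φ y)) ∈ R') (h₂ : ∀ q ∈ R', ∃ p ∈ R, q = fun y => p (φ y)) :
    (ofAlgebra R).induced φ = ofAlgebra R' := by
  have ht : ((ofAlgebra R).induced φ).topology = (ofAlgebra R').topology := by
    change TopologicalSpace.induced φ (.generateFrom _) = .generateFrom _
    rw [induced_generateFrom_eq]
    congr 1
    ext s
    constructor
    · rintro ⟨_, ⟨p, hp, rfl⟩, rfl⟩
      exact ⟨_, h₁ p hp, rfl⟩
    · rintro ⟨q, hq, rfl⟩
      obtain ⟨p, hp, rfl⟩ := h₂ q hq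
      exact ⟨_, ⟨p, hp, rfl⟩, rfl⟩
  refine ext_iff_regular ht fun f x => ?_
  constructor
  · rintro ⟨g, ⟨p, hp, q, hq, hx, hg⟩, hf⟩
    refine ⟨_, h₁ p hp, _, h₁ q hq, hx, ?_⟩
    change _ =ᶠ[@nhds Y (ofAlgebra R').topology x] _
    change _ =ᶠ[@nhds Y ((ofAlgebra R).induced φ).topology x] _ at hf
    rw [← ht]
    refine hf.trans ?_
    let _ := (ofAlgebra R).topology
    let _ := ((ofAlgebra R).induced φ).topology
    have hc : Continuous φ := continuous_induced_dom
    exact hc.continuousAt.eventually hg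
  · rintro ⟨p, hp, q, hq, hx, hf⟩
    obtain ⟨p, hp', rfl⟩ := h₂ p hp
    obtain ⟨q, hq', rfl⟩ := h₂ q hq
    refine ⟨fun y => p y / q y, ⟨p, hp', q, hq', hx, Filter.EventuallyEq.rfl⟩, ?_⟩
    change _ =ᶠ[@nhds Y ((ofAlgebra R).induced φ).topology x] _
    rw [ht]
    exact hf

end Algebra

end FunSpace

/-! ### Affine spaces -/

section AffineSpace

variable (E : Type*) [AddCommGroup E] [Module ℂ E]

/-- The algebra of polynomial functions on a vector space. -/
def polyFun : Subalgebra ℂ (E → ℂ) :=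
  Algebra.adjoin ℂ (Set.range fun (φ : Module.Dual ℂ E) (x : E) => φ x)

/-- The affine space underlying a vector space. -/
def affineSpace : FunSpace E := FunSpace.ofAlgebra (polyFun E)

variable {E} {F : Type*} [AddCommGroup F] [Module ℂ F]

lemma dual_mem_polyFun (φ : Module.Dual ℂ E) : (fun x => φ x) ∈ polyFun E :=
  Algebra.subset_adjoin ⟨φ, rfl⟩

lemma polyFun_comp_mem (L : E →ₗ[ℂ] F) {p : F → ℂ} (hp : p ∈ polyFun F) :
    (fun x => p (L x)) ∈ polyFun E := by
  induction hp using Algebra.adjoin_induction with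
  | mem p hp =>
    obtain ⟨φ, rfl⟩ := hp
    exact dual_mem_polyFun (φ.comp L)
  | algebraMap c => exact Subalgebra.algebraMap_mem _ c
  | add p q _ _ hp hq => exact add_mem hp hq
  | mul p q _ _ hp hq => exact mul_mem hp hq

lemma exists_polyFun_of_injective {L : E →ₗ[ℂ] F} (hL : Function.Injective L) {q : E → ℂ}
    (hq : q ∈ polyFun E) : ∃ p ∈ polyFun F, q = fun x => p (L x) := by
  obtain ⟨M, hM⟩ := L.exists_leftInverse_of_injective (LinearMap.ker_eq_bot.2 hL)
  refine ⟨_, polyFun_comp_mem M hq, ?_⟩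
  funext x
  exact congrArg q (LinearMap.congr_fun hM x).symm

lemma induced_affineSpace {L : E →ₗ[ℂ] F} (hL : Function.Injective L) :
    (affineSpace F).induced L = affineSpace E :=
  FunSpace.induced_ofAlgebra L (fun _ hp => polyFun_comp_mem L hp)
    (fun _ hq => exists_polyFun_of_injective hL hq)

/-- A linear subspace is the common zero set of the forms annihilating it. This makes the Lie
Grassmannian closed in each chart. -/
lemma isClosed_range_affineSpace (L : E →ₗ[ℂ] F) :
    @IsClosed F (affineSpace F).topology (Set.range L) := by
  let _ := (affineSpace F).topology
  have h : Set.range L = ⋂ φ ∈ (LinearMap.range L).dualAnnihilator, {x : F | φ x ≠ 0}ᶜ := by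
    ext x
    rw [← LinearMap.coe_range, SetLike.mem_coe,
      ← Subspace.forall_mem_dualAnnihilator_apply_eq_zero_iff]
    simp
  rw [h]
  refine isClosed_biInter fun φ _ => IsOpen.isClosed_compl ?_
  exact FunSpace.isOpen_ofAlgebra (dual_mem_polyFun φ)

lemma mem_polyFun_pi_iff {ι : Type*} [Finite ι] {p : (ι → ℂ) → ℂ} :
    p ∈ polyFun (ι → ℂ) ↔ ∃ P : MvPolynomial ι ℂ, p = fun x => MvPolynomial.aeval x P := by
  constructor
  · intro hp
    induction hp using Algebra.adjoin_induction with
    | mem p hp =>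
      obtain ⟨φ, rfl⟩ := hp
      have := Fintype.ofFinite ι
      classical
      refine ⟨∑ i, MvPolynomial.C (φ (Pi.single i 1)) * MvPolynomial.X i, ?_⟩
      funext x
      refine (LinearMap.pi_apply_eq_sum_univ φ x).trans ?_
      simp only [map_sum, map_mul, MvPolynomial.aeval_X, MvPolynomial.algHom_C,
        Algebra.algebraMap_self, RingHom.id_apply, smul_eq_mul]
      refine Finset.sum_congr rfl fun i _ => ?_
      rw [mul_comm]
      congr 2
      ext j
      simp [Pi.single_apply, eq_comm]
    | algebraMap c => exact ⟨MvPolynomial.C c, by funext x; simp⟩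
    | add p q _ _ hp hq =>
      obtain ⟨P, rfl⟩ := hp
      obtain ⟨Q, rfl⟩ := hq
      exact ⟨P + Q, by funext x; simp⟩
    | mul p q _ _ hp hq =>
      obtain ⟨P, rfl⟩ := hp
      obtain ⟨Q, rfl⟩ := hq
      exact ⟨P * Q, by funext x; simp⟩
  · rintro ⟨P, rfl⟩
    induction P using MvPolynomial.induction_on with
    | C c =>
      simp only [MvPolynomial.algHom_C]
      exact Subalgebra.algebraMap_mem (polyFun (ι → ℂ)) c
    | add P Q hP hQ =>
      simp only [map_add]
      exact add_mem hP hQ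
    | mul_X P i hP =>
      simp only [map_mul, MvPolynomial.aeval_X]
      exact mul_mem hP (dual_mem_polyFun (LinearMap.proj i : (ι → ℂ) →ₗ[ℂ] ℂ))

lemma isChart_linearEquiv (e : E ≃ₗ[ℂ] F) : FunSpace.IsChart (affineSpace F) (affineSpace E) e where
  injective := e.injective
  isOpen_range := by
    let _ := (affineSpace F).topology
    rw [e.surjective.range_eq]
    exact isOpen_univ
  induced_eq := induced_affineSpace (L := e.toLinearMap) e.injective

open MvPolynomial in
lemma isClosed_zeroLocus {ι : Type*} [Finite ι] (I : Ideal (MvPolynomial ι ℂ)) :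
    @IsClosed _ (affineSpace (ι → ℂ)).topology (zeroLocus ℂ I) := by
  let _ := (affineSpace (ι → ℂ)).topology
  have h : zeroLocus ℂ I = ⋂ P ∈ I, {x : ι → ℂ | aeval x P ≠ 0}ᶜ := by
    ext x
    simp
  rw [h]
  refine isClosed_biInter fun P _ => IsOpen.isClosed_compl ?_
  exact FunSpace.isOpen_ofAlgebra (mem_polyFun_pi_iff.2 ⟨P, rfl⟩)

open MvPolynomial in
lemma zeroLocus_vanishingIdeal_of_isClosed {ι : Type*} [Finite ι] {Z : Set (ι → ℂ)}
    (hZ : @IsClosed _ (affineSpace (ι → ℂ)).topology Z) :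
    zeroLocus ℂ (vanishingIdeal ℂ Z) = Z := by
  let _ := (affineSpace (ι → ℂ)).topology
  refine Set.Subset.antisymm (fun x hx => ?_) (zeroLocus_vanishingIdeal_le Z)
  by_contra hxZ
  obtain ⟨_, ⟨p, hp, rfl⟩, hxp, hpZ⟩ :=
    (FunSpace.isTopologicalBasis_ofAlgebra (polyFun (ι → ℂ))).exists_subset_of_mem_open
      (show x ∈ Zᶜ from hxZ) hZ.isOpen_compl
  obtain ⟨P, rfl⟩ := mem_polyFun_pi_iff.1 hp
  refine hxp (hx P fun y hy => ?_)
  by_contra h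
  exact hpZ h hy

open MvPolynomial in
lemma vanishingIdeal_isPrime {ι : Type*} [Finite ι] {Z : Set (ι → ℂ)}
    (hZ : @IsIrreducible _ (affineSpace (ι → ℂ)).topology Z) :
    (vanishingIdeal ℂ Z).IsPrime := by
  let _ := (affineSpace (ι → ℂ)).topology
  refine ⟨fun h => ?_, fun {P Q} hPQ => ?_⟩
  · obtain ⟨x, hx⟩ := hZ.nonempty
    have h1 : (1 : MvPolynomial ι ℂ) ∈ vanishingIdeal ℂ Z := h ▸ Submodule.mem_top
    simpa using h1 x hx
  · by_contra! h
    simp only [mem_vanishingIdeal_iff, not_forall] at h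
    obtain ⟨⟨x, hx, hPx⟩, ⟨y, hy, hQy⟩⟩ := h
    obtain ⟨z, hz, hz1, hz2⟩ := hZ.2 {x | aeval x P ≠ 0} {x | aeval x Q ≠ 0}
      (FunSpace.isOpen_ofAlgebra (mem_polyFun_pi_iff.2 ⟨P, rfl⟩))
      (FunSpace.isOpen_ofAlgebra (mem_polyFun_pi_iff.2 ⟨Q, rfl⟩)) ⟨x, hx, hPx⟩ ⟨y, hy, hQy⟩
    have := hPQ z hz
    rw [map_mul] at this
    exact mul_ne_zero hz1 hz2 this

open MvPolynomial in
-- If P ≠ 0 and Q ≠ 0 each met the locus but never at a common point, then PQ would vanish on it. By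
-- the Nullstellensatz PQ would lie in the prime I, hence P or Q would.
lemma isIrreducible_zeroLocus {ι : Type*} [Finite ι] (I : Ideal (MvPolynomial ι ℂ))
    [hI : I.IsPrime] :
    @IsIrreducible _ (affineSpace (ι → ℂ)).topology (zeroLocus ℂ I) := by
  let _ := (affineSpace (ι → ℂ)).topology
  have hv := IsPrime.vanishingIdeal_zeroLocus (K := ℂ) I
  have hb := FunSpace.isTopologicalBasis_ofAlgebra (polyFun (ι → ℂ))
  refine ⟨?_, ?_⟩
  · rw [Set.nonempty_iff_ne_empty]
    intro h
    rw [h, vanishingIdeal_empty] at hv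
    exact hI.ne_top hv.symm
  · rintro U₁ U₂ h₁ h₂ ⟨x, hx, hx1⟩ ⟨y, hy, hy1⟩
    obtain ⟨_, ⟨p, hp, rfl⟩, hxp, hpZ⟩ := hb.exists_subset_of_mem_open hx1 h₁
    obtain ⟨_, ⟨q, hq, rfl⟩, hyq, hqZ⟩ := hb.exists_subset_of_mem_open hy1 h₂
    obtain ⟨P, rfl⟩ := mem_polyFun_pi_iff.1 hp
    obtain ⟨Q, rfl⟩ := mem_polyFun_pi_iff.1 hq
    by_contra hne
    have hPQ : P * Q ∈ vanishingIdeal ℂ (zeroLocus ℂ I) := by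
      intro z hz
      by_contra h0
      rw [map_mul] at h0
      exact hne ⟨z, hz, hpZ (left_ne_zero_of_mul h0), hqZ (right_ne_zero_of_mul h0)⟩
    rw [hv] at hPQ
    rcases hI.mem_or_mem hPQ with h | h
    · exact hxp (hx P h)
    · exact hyq (hy Q h)

open MvPolynomial in
-- By the Nullstellensatz, irreducible closed sets correspond with reversed inclusions to primes of
-- the polynomial ring, whose Krull dimension is the number of variables.
lemma dim_affineSpace_pi (ι : Type*) [Finite ι] :
    (affineSpace (ι → ℂ)).dim = (Nat.card ι : WithBot ℕ∞) := by
  let _ := (affineSpace (ι → ℂ)).topology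
  let e : TopologicalSpace.IrreducibleCloseds (ι → ℂ) ≃o
      (PrimeSpectrum (MvPolynomial ι ℂ))ᵒᵈ :=
    { toFun := fun Z => OrderDual.toDual ⟨vanishingIdeal ℂ Z.1, vanishingIdeal_isPrime Z.2⟩
      invFun := fun P => ⟨zeroLocus ℂ (OrderDual.ofDual P).asIdeal,
        @isIrreducible_zeroLocus _ _ _ (OrderDual.ofDual P).2, isClosed_zeroLocus _⟩
      left_inv := fun Z => TopologicalSpace.IrreducibleCloseds.ext
        (zeroLocus_vanishingIdeal_of_isClosed Z.3)
      right_inv := fun P => by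
        have := (OrderDual.ofDual P).2
        exact congrArg OrderDual.toDual
          (PrimeSpectrum.ext
            (IsPrime.vanishingIdeal_zeroLocus (K := ℂ) (OrderDual.ofDual P).asIdeal))
      map_rel_iff' := by
        intro Z Z'
        change vanishingIdeal ℂ Z'.1 ≤ vanishingIdeal ℂ Z.1 ↔ Z.1 ⊆ Z'.1
        rw [← le_zeroLocus_iff_le_vanishingIdeal, zeroLocus_vanishingIdeal_of_isClosed Z'.3] }
  change Order.krullDim _ = _
  rw [Order.krullDim_eq_of_orderIso e, Order.krullDim_orderDual]
  change ringKrullDim _ = _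
  rw [MvPolynomial.ringKrullDim_of_isNoetherianRing]
  simp

lemma irreducible_affineSpace_pi (ι : Type*) [Finite ι] : (affineSpace (ι → ℂ)).Irreducible := by
  let _ := (affineSpace (ι → ℂ)).topology
  have h := isIrreducible_zeroLocus (⊥ : Ideal (MvPolynomial ι ℂ))
  rw [MvPolynomial.zeroLocus_bot] at h
  exact irreducibleSpace_def _ |>.2 h

open MvPolynomial in
/-- The local rings of affine space are the localizations of the polynomial ring. -/
lemma smooth_affineSpace_pi (ι : Type*) [Finite ι] : (affineSpace (ι → ℂ)).Smooth := by
  intro x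
  let _ := (affineSpace (ι → ℂ)).topology
  let R := MvPolynomial ι ℂ
  let A := (affineSpace (ι → ℂ)).localRing x
  have hr : ∀ P : R, (affineSpace (ι → ℂ)).IsRegularAt (fun y => aeval y P) x := fun P =>
    FunSpace.isRegularAt_ofAlgebra (mem_polyFun_pi_iff.2 ⟨P, rfl⟩) x
  let g : R →+* A :=
    { toFun := fun P => ⟨((fun y => aeval y P : (ι → ℂ) → ℂ) : (𝓝 x).Germ ℂ), _, hr P, rfl⟩
      map_one' := by
        apply Subtype.ext
        simp only [map_one]
        rfl
      map_zero' := by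
        apply Subtype.ext
        simp only [map_zero]
        rfl
      map_mul' := fun P Q => by
        apply Subtype.ext
        simp only [map_mul]
        rfl
      map_add' := fun P Q => by
        apply Subtype.ext
        simp only [map_add]
        rfl }
  let _ : Algebra R A := g.toAlgebra
  let m : Ideal R := vanishingIdeal ℂ {x}
  have hm : ∀ P : R, P ∈ m.primeCompl ↔ aeval x P ≠ 0 := fun P =>
    not_congr (mem_vanishingIdeal_singleton_iff x P)
  have hloc : IsLocalization.AtPrime A m := by
    refine ⟨⟨?_, ?_, ?_⟩⟩
    · rintro ⟨P, hP⟩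
      rw [hm] at hP
      have hi := (affineSpace (ι → ℂ)).inv (hr P) hP
      refine IsUnit.of_mul_eq_one (⟨_, _, hi, rfl⟩ : A) (Subtype.ext ?_)
      refine Filter.Germ.coe_eq.2 ?_
      filter_upwards [FunSpace.nonvanishing_mem_nhds _ (mem_polyFun_pi_iff.2 ⟨P, rfl⟩) hP] with y hy
      exact mul_inv_cancel₀ hy
    · rintro ⟨_, f, ⟨p, hp, q, hq, hx, hf⟩, rfl⟩
      obtain ⟨P, rfl⟩ := mem_polyFun_pi_iff.1 hp
      obtain ⟨Q, rfl⟩ := mem_polyFun_pi_iff.1 hq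
      refine ⟨⟨P, Q, (hm Q).2 hx⟩, Subtype.ext (Filter.Germ.coe_eq.2 ?_)⟩
      filter_upwards [hf, FunSpace.nonvanishing_mem_nhds _ hq hx] with y h1 h2
      change f y * _ = _
      rw [h1]
      exact div_mul_cancel₀ _ h2
    -- Polynomials with the same germ at x agree wherever some C with C(x) ≠ 0 does not vanish. Then
    -- CP and CQ agree at every point, hence are equal as polynomials since ℂ is infinite.
    · intro P Q hPQ
      have h1 := Filter.Germ.coe_eq.1 (congrArg Subtype.val hPQ)
      obtain ⟨_, ⟨c, hc, rfl⟩, hxc, hcU⟩ :=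
        (FunSpace.isTopologicalBasis_ofAlgebra (polyFun (ι → ℂ))).mem_nhds_iff.1 h1
      obtain ⟨C, rfl⟩ := mem_polyFun_pi_iff.1 hc
      refine ⟨⟨C, (hm C).2 hxc⟩, MvPolynomial.funext fun y => ?_⟩
      by_cases hy : aeval y C = 0
      · have hy' : eval y C = 0 := hy
        simp [hy']
      · have h2 : eval y P = eval y Q := hcU hy
        simp [h2]
  have : IsRegularLocalRing (Localization.AtPrime m) :=
    IsRegularRing.isRegularLocalRing_localization m
  exact IsRegularLocalRing.of_ringEquiv
    (IsLocalization.algEquiv m.primeCompl (Localization.AtPrime m) A).toRingEquiv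

variable (E) [FiniteDimensional ℂ E]

lemma smooth_affineSpace : (affineSpace E).Smooth :=
  FunSpace.smooth_of_charts fun x => ⟨_, _, _,
    isChart_linearEquiv (Module.finBasis ℂ E).equivFun.symm, smooth_affineSpace_pi _,
    (Module.finBasis ℂ E).equivFun.symm.surjective x⟩

lemma dim_affineSpace : (affineSpace E).dim = (Module.finrank ℂ E : WithBot ℕ∞) :=
  FunSpace.dim_of_charts fun x => ⟨_, _, _,
    isChart_linearEquiv (Module.finBasis ℂ E).equivFun.symm, by rw [dim_affineSpace_pi]; simp,
    (Module.finBasis ℂ E).equivFun.symm.surjective x⟩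

lemma irreducible_affineSpace : (affineSpace E).Irreducible := by
  let e := (Module.finBasis ℂ E).equivFun.symm
  refine FunSpace.irreducible_of_charts fun x => ⟨_, _, e, isChart_linearEquiv e,
    irreducible_affineSpace_pi _, e.surjective x, fun y => ?_⟩
  let _ := (affineSpace E).topology
  let _ := (affineSpace (Fin (Module.finrank ℂ E) → ℂ)).topology
  have : IrreducibleSpace (Fin (Module.finrank ℂ E) → ℂ) := irreducible_affineSpace_pi _
  refine ⟨Set.univ, isOpen_univ, trivial, ?_, ⟨e 0, trivial, 0, rfl⟩⟩
  rw [← e.surjective.range_eq, ← Set.image_univ]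
  exact (IrreducibleSpace.isIrreducible_univ _).2.image e
    (isChart_linearEquiv e).isOpenEmbedding.continuous.continuousOn

end AffineSpace

/-! ### Affine charts of projective space -/

section ProjectiveCharts

variable {W : Type*} [AddCommGroup W] [Module ℂ W] {E : Type*} [AddCommGroup E] [Module ℂ E]

lemma evalForm_smul {d : ℕ} {F : MvPolynomial (Module.Dual ℂ W) ℂ} (hF : F.IsHomogeneous d)
    (c : ℂ) (x : W) : evalForm F (c • x) = c ^ d * evalForm F x := by
  unfold evalForm
  rw [MvPolynomial.eval_eq, MvPolynomial.eval_eq, Finset.mul_sum]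
  refine Finset.sum_congr rfl fun m hm => ?_
  have hd : ∑ i ∈ m.support, m i = d := by
    have := hF (MvPolynomial.mem_support_iff.1 hm)
    rwa [Pi.one_def, ← Finsupp.degree_eq_weight_one] at this
  simp only [map_smul, smul_eq_mul, mul_pow, Finset.prod_mul_distrib]
  rw [Finset.prod_pow_eq_pow_sum, hd]
  ring

lemma evalForm_rep_mk {d : ℕ} {F : MvPolynomial (Module.Dual ℂ W) ℂ} (hF : F.IsHomogeneous d)
    {v : W} (hv : v ≠ 0) {a : ℂˣ} (ha : a • v = (Projectivization.mk ℂ v hv).rep) :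
    evalForm F (Projectivization.mk ℂ v hv).rep = (a : ℂ) ^ d * evalForm F v := by
  rw [← ha, ← evalForm_smul hF]
  rfl

lemma evalForm_rep_ne_zero_iff {d : ℕ} {F : MvPolynomial (Module.Dual ℂ W) ℂ}
    (hF : F.IsHomogeneous d) {v : W} (hv : v ≠ 0) :
    evalForm F (Projectivization.mk ℂ v hv).rep ≠ 0 ↔ evalForm F v ≠ 0 := by
  obtain ⟨a, ha⟩ := Projectivization.exists_smul_eq_mk_rep ℂ v hv
  rw [evalForm_rep_mk hF hv ha]
  simp

lemma evalForm_rep_div {d : ℕ} {F G : MvPolynomial (Module.Dual ℂ W) ℂ}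
    (hF : F.IsHomogeneous d) (hG : G.IsHomogeneous d) {v : W} (hv : v ≠ 0) :
    evalForm F (Projectivization.mk ℂ v hv).rep / evalForm G (Projectivization.mk ℂ v hv).rep =
      evalForm F v / evalForm G v := by
  obtain ⟨a, ha⟩ := Projectivization.exists_smul_eq_mk_rep ℂ v hv
  rw [evalForm_rep_mk hF hv ha, evalForm_rep_mk hG hv ha]
  exact mul_div_mul_left _ _ (by simp)

lemma evalForm_comp_mem_polyFun {ω : E → W}
    (h : ∀ φ : Module.Dual ℂ W, (fun x => φ (ω x)) ∈ polyFun E)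
    (F : MvPolynomial (Module.Dual ℂ W) ℂ) : (fun x => evalForm F (ω x)) ∈ polyFun E := by
  unfold evalForm
  induction F using MvPolynomial.induction_on with
  | C c =>
    simp only [MvPolynomial.eval_C]
    exact Subalgebra.algebraMap_mem _ c
  | add P Q hP hQ =>
    simp only [map_add]
    exact add_mem hP hQ
  | mul_X P φ hP =>
    simp only [map_mul, MvPolynomial.eval_X]
    exact mul_mem hP (h φ)

/-- Homogenization: l equals 1 along ω, so multiplication by powers of l adjusts degrees without
changing values. -/
lemma exists_homogeneous_evalForm_eq {ω : E → W} {l : Module.Dual ℂ W} (hl : ∀ x, l (ω x) = 1)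
    (h : ∀ ψ : Module.Dual ℂ E, ∃ φ : Module.Dual ℂ W, ∀ x, φ (ω x) = ψ x)
    {p : E → ℂ} (hp : p ∈ polyFun E) :
    ∃ (d : ℕ) (F : MvPolynomial (Module.Dual ℂ W) ℂ), F.IsHomogeneous d ∧
      ∀ x, evalForm F (ω x) = p x := by
  induction hp using Algebra.adjoin_induction with
  | mem p hp =>
    obtain ⟨ψ, rfl⟩ := hp
    obtain ⟨φ, hφ⟩ := h ψ
    exact ⟨1, MvPolynomial.X φ, MvPolynomial.isHomogeneous_X _ _, fun x => by
      simpa [evalForm] using hφ x⟩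
  | algebraMap c =>
    exact ⟨0, MvPolynomial.C c, MvPolynomial.isHomogeneous_C _ c, fun x => by simp [evalForm]⟩
  | add p q _ _ hp hq =>
    obtain ⟨d, F, hF, hFp⟩ := hp
    obtain ⟨e, G, hG, hGq⟩ := hq
    refine ⟨d + e, F * MvPolynomial.X l ^ e + G * MvPolynomial.X l ^ d, ?_, fun x => ?_⟩
    · refine (hF.mul (MvPolynomial.isHomogeneous_X_pow l e)).add ?_
      rw [add_comm d e]
      exact hG.mul (MvPolynomial.isHomogeneous_X_pow l d)
    · have h1 := hFp x
      have h2 := hGq x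
      unfold evalForm at h1 h2 ⊢
      simp [hl, h1, h2]
  | mul p q _ _ hp hq =>
    obtain ⟨d, F, hF, hFp⟩ := hp
    obtain ⟨e, G, hG, hGq⟩ := hq
    refine ⟨d + e, F * G, hF.mul hG, fun x => ?_⟩
    have h1 := hFp x
    have h2 := hGq x
    unfold evalForm at h1 h2 ⊢
    simp [h1, h2]

/-- Regular functions on projective space are quotients of forms of equal degree; the common degree
is reached by padding with powers of l. -/
lemma exists_homogeneous_pair {ω : E → W} {l : Module.Dual ℂ W} (hl : ∀ x, l (ω x) = 1)
    (h : ∀ ψ : Module.Dual ℂ E, ∃ φ : Module.Dual ℂ W, ∀ x, φ (ω x) = ψ x)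
    {p q : E → ℂ} (hp : p ∈ polyFun E) (hq : q ∈ polyFun E) :
    ∃ (d : ℕ) (F G : MvPolynomial (Module.Dual ℂ W) ℂ), F.IsHomogeneous d ∧ G.IsHomogeneous d ∧
      (∀ x, evalForm F (ω x) = p x) ∧ ∀ x, evalForm G (ω x) = q x := by
  obtain ⟨d, F, hF, hFp⟩ := exists_homogeneous_evalForm_eq hl h hp
  obtain ⟨e, G, hG, hGq⟩ := exists_homogeneous_evalForm_eq hl h hq
  refine ⟨d + e, F * MvPolynomial.X l ^ e, G * MvPolynomial.X l ^ d,
    hF.mul (MvPolynomial.isHomogeneous_X_pow l e), ?_, fun x => ?_, fun x => ?_⟩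
  · rw [add_comm d e]
    exact hG.mul (MvPolynomial.isHomogeneous_X_pow l d)
  · have h1 := hFp x
    unfold evalForm at h1 ⊢
    simp [hl, h1]
  · have h1 := hGq x
    unfold evalForm at h1 ⊢
    simp [hl, h1]

/-- A polynomial parametrization of part of an affine chart of a projective space, whose
coordinates include the linear coordinates, induces the structure of an affine space. -/
lemma induced_projSpace {ω : E → W} (hω : ∀ x, ω x ≠ 0)
    (h₁ : ∀ φ : Module.Dual ℂ W, (fun x => φ (ω x)) ∈ polyFun E)
    {l : Module.Dual ℂ W} (hl : ∀ x, l (ω x) = 1)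
    (h₂ : ∀ ψ : Module.Dual ℂ E, ∃ φ : Module.Dual ℂ W, ∀ x, φ (ω x) = ψ x) :
    (projSpace W).induced (fun x => Projectivization.mk ℂ (ω x) (hω x)) = affineSpace E := by
  set p : E → ℙ ℂ W := fun x => Projectivization.mk ℂ (ω x) (hω x) with hp
  have ht : ((projSpace W).induced p).topology = (affineSpace E).topology := by
    change TopologicalSpace.induced p (.generateFrom _) = .generateFrom _
    rw [induced_generateFrom_eq]
    congr 1
    ext s
    constructor
    · rintro ⟨_, ⟨d, F, hF, rfl⟩, rfl⟩
      refine ⟨_, evalForm_comp_mem_polyFun h₁ F, ?_⟩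
      ext x
      exact evalForm_rep_ne_zero_iff hF (hω x)
    · rintro ⟨q, hq, rfl⟩
      obtain ⟨d, F, hF, hFq⟩ := exists_homogeneous_evalForm_eq hl h₂ hq
      refine ⟨_, ⟨d, F, hF, rfl⟩, ?_⟩
      ext x
      simp only [Set.mem_preimage, Set.mem_ofPred_eq, ← hFq x]
      exact evalForm_rep_ne_zero_iff hF (hω x)
  refine FunSpace.ext_iff_regular ht fun f x => ?_
  constructor
  · rintro ⟨g, ⟨d, F, G, hF, hG, hx, hg⟩, hf⟩
    refine ⟨_, evalForm_comp_mem_polyFun h₁ F, _, evalForm_comp_mem_polyFun h₁ G,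
      (evalForm_rep_ne_zero_iff hG (hω x)).1 hx, ?_⟩
    change _ =ᶠ[@nhds E (affineSpace E).topology x] _
    change _ =ᶠ[@nhds E ((projSpace W).induced p).topology x] _ at hf
    rw [← ht]
    let _ := (projSpace W).topology
    let _ := ((projSpace W).induced p).topology
    have hc : Continuous p := continuous_induced_dom
    filter_upwards [hf, hc.continuousAt.eventually hg] with y h3 h4
    rw [h3, h4]
    exact evalForm_rep_div hF hG (hω y)
  · rintro ⟨a, ha, b, hb, hx, hf⟩
    obtain ⟨d, F, G, hF, hG, hFa, hGb⟩ := exists_homogeneous_pair hl h₂ ha hb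
    refine ⟨_, ⟨d, F, G, hF, hG, ?_, Filter.EventuallyEq.rfl⟩, ?_⟩
    · rw [hp, evalForm_rep_ne_zero_iff hG (hω x), hGb]
      exact hx
    · change _ =ᶠ[@nhds E ((projSpace W).induced p).topology x] _
      rw [ht]
      refine Filter.EventuallyEq.trans hf (Filter.Eventually.of_forall fun y => ?_)
      refine ((evalForm_rep_div hF hG (hω y)).trans ?_).symm
      rw [hFa, hGb]

/-- Expanding every argument in a basis of V gives a sum of products of coordinates. It is used for
the Plücker coordinates of a graph. -/
lemma multilinear_comp_mem_polyFun {V : Type*} [AddCommGroup V] [Module ℂ V]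
    [FiniteDimensional ℂ V] {d : ℕ} (m : MultilinearMap ℂ (fun _ : Fin d => V) ℂ)
    {c : Fin d → E → V} (hc : ∀ i (φ : Module.Dual ℂ V), (fun x => φ (c i x)) ∈ polyFun E) :
    (fun x => m fun i => c i x) ∈ polyFun E := by
  let b := Module.finBasis ℂ V
  have h : (fun x => m fun i => c i x) =
      ∑ r : Fin d → Fin (Module.finrank ℂ V),
        (∏ i, fun x => b.coord (r i) (c i x)) * algebraMap ℂ (E → ℂ) (m fun i => b (r i)) := by
    funext x
    have h1 : (fun i => c i x) = fun i => ∑ j, b.coord j (c i x) • b j := by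
      funext i
      exact (b.sum_repr (c i x)).symm
    rw [h1, MultilinearMap.map_sum]
    simp only [Finset.sum_apply, Pi.mul_apply, Finset.prod_apply]
    refine Finset.sum_congr rfl fun r _ => ?_
    rw [MultilinearMap.map_smul_univ]
    rfl
  rw [h]
  exact sum_mem fun r _ => mul_mem (prod_mem fun i _ => hc i _) (Subalgebra.algebraMap_mem _ _)

end ProjectiveCharts

/-! ### Affine charts of Grassmannians -/

section GrassmannianCharts

variable {V : Type*} [AddCommGroup V] [Module ℂ V] {A B : Submodule ℂ V}

/-- On U an alternating map in dim U variables is fixed by its value on one basis, so another family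
changes the wedge only by a determinant. The arbitrary basis in `plucker` can thus be replaced by
one adapted to a chart. -/
lemma plucker_eq_mk [FiniteDimensional ℂ V] {d : ℕ} (U : Gr V d) {b : Fin d → V}
    (hb : LinearIndependent ℂ b) (hbU : ∀ i, b i ∈ U.1) :
    plucker U = Projectivization.mk ℂ (exteriorPower.ιMulti ℂ d b)
      (ιMulti_ne_zero_of_linearIndependent hb) := by
  let e := Module.finBasisOfFinrankEq ℂ U.1 U.2
  let g : U.1 [⋀^Fin d]→ₗ[ℂ] ⋀[ℂ]^d V :=
    (exteriorPower.ιMulti ℂ d).compLinearMap U.1.subtype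
  have hg : g = (LinearMap.toSpanSingleton ℂ _ (g e)).compAlternatingMap e.det := by
    refine Module.Basis.ext_alternating e fun i h => ?_
    -- An injective choice of indices is a permutation, and both sides pick up its sign.
    let σ : Equiv.Perm (Fin d) := Equiv.ofBijective i (Finite.injective_iff_bijective.1 h)
    change g (e ∘ σ) = e.det (e ∘ σ) • g e
    simp [AlternatingMap.map_perm, Module.Basis.det_self]
  symm
  rw [plucker, Projectivization.mk_eq_mk_iff']
  let c : Fin d → U.1 := fun i => ⟨b i, hbU i⟩
  have hc : g c = e.det c • g e := by
    conv_lhs => rw [hg]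
    rfl
  have h1 : g c = exteriorPower.ιMulti ℂ d b := AlternatingMap.compLinearMap_apply _ _ _
  have h2 : g e = exteriorPower.ιMulti ℂ d fun i => (e i : V) :=
    AlternatingMap.compLinearMap_apply _ _ _
  exact ⟨e.det c, by rw [← h1, ← h2, hc]⟩

variable (A B) in
/-- The map `a ↦ a + f a` parametrizing the graph of `f : A → B`. -/
def graphMap (f : A →ₗ[ℂ] B) : A →ₗ[ℂ] V := A.subtype + B.subtype ∘ₗ f

@[simp]
lemma graphMap_apply (f : A →ₗ[ℂ] B) (a : A) : graphMap A B f a = a + f a := rfl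

lemma projectionOnto_graphMap (h : IsCompl A B) (f : A →ₗ[ℂ] B) (a : A) :
    A.projectionOnto B h (graphMap A B f a) = a := by
  simp

lemma projectionOnto_symm_graphMap (h : IsCompl A B) (f : A →ₗ[ℂ] B) (a : A) :
    B.projectionOnto A h.symm (graphMap A B f a) = f a := by
  simp

lemma graphMap_injective (h : IsCompl A B) (f : A →ₗ[ℂ] B) :
    Function.Injective (graphMap A B f) :=
  Function.LeftInverse.injective (projectionOnto_graphMap h f)

/-- The graph of a linear map `f : A → B` between complementary subspaces, as a point of the
Grassmannian. -/
def graphGr {d : ℕ} (h : IsCompl A B) (hd : Module.finrank ℂ A = d) (f : A →ₗ[ℂ] B) : Gr V d :=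
  ⟨LinearMap.range (graphMap A B f),
    (LinearMap.finrank_range_of_inj (graphMap_injective h f)).trans hd⟩

lemma mem_graphGr_iff {d : ℕ} (h : IsCompl A B) (hd : Module.finrank ℂ A = d) (f : A →ₗ[ℂ] B)
    {x : V} : x ∈ (graphGr h hd f).1 ↔
      (B.projectionOnto A h.symm x) = f (A.projectionOnto B h x) := by
  constructor
  · rintro ⟨a, rfl⟩
    rw [projectionOnto_graphMap h, projectionOnto_symm_graphMap h]
  · intro hx
    refine ⟨A.projectionOnto B h x, ?_⟩
    rw [graphMap_apply, ← hx]
    exact Submodule.projection_add_projection_eq_self h x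

lemma graphGr_injective {d : ℕ} (h : IsCompl A B) (hd : Module.finrank ℂ A = d) :
    Function.Injective (graphGr h hd) := by
  intro f g hfg
  ext1 a
  have h1 : graphMap A B f a ∈ (graphGr h hd g).1 := hfg ▸ ⟨a, rfl⟩
  rwa [mem_graphGr_iff, projectionOnto_graphMap h, projectionOnto_symm_graphMap h] at h1

/-- The linear form on `⋀^d V` given by the determinant of a linear map `V → A`. -/
def detForm {d : ℕ} (a : Module.Basis (Fin d) ℂ A) (T : V →ₗ[ℂ] A) :
    Module.Dual ℂ (⋀[ℂ]^d V) :=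
  exteriorPower.alternatingMapLinearEquiv (a.det.compLinearMap T)

lemma detForm_ιMulti {d : ℕ} (a : Module.Basis (Fin d) ℂ A) (T : V →ₗ[ℂ] A) (v : Fin d → V) :
    detForm a T (exteriorPower.ιMulti ℂ d v) = a.det fun i => T (v i) :=
  exteriorPower.alternatingMapLinearEquiv_apply_ιMulti _ _

variable [FiniteDimensional ℂ V]

/-- A subspace of dimension dim A that avoids B projects isomorphically onto A along B, hence is a
graph. -/
lemma range_graphGr {d : ℕ} (h : IsCompl A B) (hd : Module.finrank ℂ A = d) :
    Set.range (graphGr h hd) = {U | Disjoint U.1 B} := by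
  ext U
  constructor
  · rintro ⟨f, rfl⟩
    rw [Set.mem_ofPred_eq, Submodule.disjoint_def]
    intro x hx hxB
    obtain ⟨a, rfl⟩ := hx
    have h0 := (Submodule.projectionOnto_apply_eq_zero_iff h).2 hxB
    rw [projectionOnto_graphMap] at h0
    rw [h0, map_zero]
  · intro hU
    rw [Set.mem_ofPred_eq, Submodule.disjoint_def] at hU
    let π := A.projectionOnto B h ∘ₗ U.1.subtype
    have hπ : Function.Injective π := by
      rw [← LinearMap.ker_eq_bot, LinearMap.ker_eq_bot']
      intro x hx
      exact Subtype.ext (hU x x.2 ((Submodule.projectionOnto_apply_eq_zero_iff h).1 hx))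
    let e : U.1 ≃ₗ[ℂ] A := LinearEquiv.ofInjectiveOfFinrankEq π hπ (U.2.trans hd.symm)
    refine ⟨B.projectionOnto A h.symm ∘ₗ U.1.subtype ∘ₗ e.symm.toLinearMap, ?_⟩
    refine Subtype.ext (Submodule.eq_of_le_of_finrank_eq ?_ ?_).symm
    · intro x hx
      rw [mem_graphGr_iff]
      have h1 : A.projectionOnto B h x = e ⟨x, hx⟩ := rfl
      rw [h1]
      simp
    · rw [U.2, (graphGr h hd _).2]

/-- The graph of f has the basis a_i + f(a_i), so its Plücker coordinates are polynomial in f. The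
coordinate `l`, the determinant of the projection to A, is 1 on all these wedges and its
nonvanishing defines the chart. Every linear form in f comes from a linear form on ⋀^d V, so
`induced_projSpace` applies. -/
lemma isChart_graphGr {d : ℕ} (h : IsCompl A B) (hd : Module.finrank ℂ A = d) :
    FunSpace.IsChart (grassmannian V d) (affineSpace (A →ₗ[ℂ] B)) (graphGr h hd) := by
  let a := Module.finBasisOfFinrankEq ℂ A hd
  let v : (A →ₗ[ℂ] B) → Fin d → V := fun f i => graphMap A B f (a i)
  have hv : ∀ f, LinearIndependent ℂ (v f) := fun f =>
    a.linearIndependent.map' _ (LinearMap.ker_eq_bot.2 (graphMap_injective h f))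
  let ω : (A →ₗ[ℂ] B) → ⋀[ℂ]^d V := fun f => exteriorPower.ιMulti ℂ d (v f)
  let l := detForm a (A.projectionOnto B h)
  refine ⟨graphGr_injective h hd, ?_, ?_⟩
  · refine ⟨_, TopologicalSpace.isOpen_generateFrom_of_mem
      ⟨1, MvPolynomial.X l, MvPolynomial.isHomogeneous_X _ _, rfl⟩, ?_⟩
    rw [range_graphGr]
    ext U
    let b := Module.finBasisOfFinrankEq ℂ U.1 U.2
    have hb : LinearIndependent ℂ fun i => (b i : V) :=
      b.linearIndependent.map' U.1.subtype (Submodule.ker_subtype _)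
    have h1 : plucker U ∈ {x : ℙ ℂ (⋀[ℂ]^d V) | evalForm (MvPolynomial.X l) x.rep ≠ 0} ↔
        a.det (fun i => A.projectionOnto B h (b i)) ≠ 0 := by
      rw [plucker_eq_mk U hb fun i => (b i).2, Set.mem_ofPred_eq,
        evalForm_rep_ne_zero_iff (MvPolynomial.isHomogeneous_X _ _)]
      simp only [evalForm, MvPolynomial.eval_X]
      rw [detForm_ιMulti]
    rw [Set.mem_preimage, h1, ← isUnit_iff_ne_zero, ← Module.Basis.is_basis_iff_det,
      Set.mem_ofPred_eq]
    let π := A.projectionOnto B h ∘ₗ U.1.subtype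
    have hπ : LinearMap.ker π = ⊥ ↔ Disjoint U.1 B := by
      rw [LinearMap.ker_eq_bot', Submodule.disjoint_def]
      constructor
      · intro H x hx hxB
        exact congrArg Subtype.val
          (H ⟨x, hx⟩ ((Submodule.projectionOnto_apply_eq_zero_iff h).2 hxB))
      · intro H x hx
        exact Subtype.ext (H x x.2 ((Submodule.projectionOnto_apply_eq_zero_iff h).1 hx))
    rw [← hπ]
    constructor
    · rintro ⟨hli, -⟩
      exact LinearMap.ker_eq_bot.2 (LinearMap.injective_of_linearIndependent b.span_eq hli)
    · intro hk
      have hli := b.linearIndependent.map' π hk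
      refine ⟨hli, ?_⟩
      apply hli.span_eq_top_of_card_eq_finrank'
      rw [hd, Fintype.card_fin]
  · have hp : ∀ f, plucker (graphGr h hd f) = Projectivization.mk ℂ (ω f)
        (ιMulti_ne_zero_of_linearIndependent (hv f)) := fun f =>
      plucker_eq_mk _ (hv f) fun i => ⟨a i, rfl⟩
    have hi := FunSpace.induced_induced (projSpace (⋀[ℂ]^d V)) plucker (graphGr h hd)
    change FunSpace.induced (FunSpace.induced _ _) _ = _
    rw [hi]
    have hc : plucker ∘ graphGr h hd = fun f => Projectivization.mk ℂ (ω f)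
        (ιMulti_ne_zero_of_linearIndependent (hv f)) := funext hp
    rw [hc]
    refine induced_projSpace _ (fun φ => ?_) (l := l) (fun f => ?_) fun ψ => ?_
    · refine multilinear_comp_mem_polyFun
        (φ.compAlternatingMap (exteriorPower.ιMulti ℂ d)).toMultilinearMap
        (c := fun i f => v f i) fun i χ => ?_
      have h3 : (fun f : A →ₗ[ℂ] B => χ (v f i)) =
          (algebraMap ℂ ((A →ₗ[ℂ] B) → ℂ) (χ (a i))) +
          fun f : A →ₗ[ℂ] B => (χ ∘ₗ B.subtype ∘ₗ LinearMap.applyₗ (R := ℂ) (a i)) f := by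
        funext f
        simp [v]
      rw [h3]
      exact add_mem (Subalgebra.algebraMap_mem _ _) (dual_mem_polyFun _)
    · change detForm a _ (exteriorPower.ιMulti ℂ d (v f)) = 1
      rw [detForm_ιMulti]
      simp only [v, projectionOnto_graphMap]
      exact a.det_self
    -- Writing f as the sum of its rank-one pieces x ↦ a_i^*(x) f(a_i) gives ψ f = ∑ β_i(f(a_i)).
    · let β : Fin d → Module.Dual ℂ B := fun i =>
        { toFun := fun y => ψ ((LinearMap.toSpanSingleton ℂ B y) ∘ₗ a.coord i)
          map_add' := fun y z => by
            rw [← map_add]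
            congr 1
            ext x
            simp
          map_smul' := fun c y => by
            rw [RingHom.id_apply, ← map_smul]
            congr 1
            ext x
            simp [smul_comm c] }
      have hψ : ∀ f, ψ f = ∑ i, β i (f (a i)) := by
        intro f
        have h4 : f = ∑ i, (LinearMap.toSpanSingleton ℂ B (f (a i))) ∘ₗ a.coord i := by
          refine a.ext fun j => ?_
          simp [LinearMap.sum_apply, Finsupp.single_apply, ite_smul]
        conv_lhs => rw [h4]
        rw [map_sum]
        rfl
      -- `T i` is the projection to A with its i-th coordinate replaced by β_i of the projection to
      -- B. On the basis of the graph its matrix is the identity with row i replaced by the numbers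
      -- β_i(f(a_k)), so its determinant is β_i(f(a_i)).
      let T : Fin d → V →ₗ[ℂ] A := fun i =>
        A.projectionOnto B h +
          LinearMap.toSpanSingleton ℂ A (a i) ∘ₗ
            (β i ∘ₗ B.projectionOnto A h.symm - a.coord i ∘ₗ A.projectionOnto B h)
      refine ⟨∑ i, detForm a (T i), fun f => ?_⟩
      rw [hψ, LinearMap.sum_apply]
      refine Finset.sum_congr rfl fun i _ => ?_
      change detForm a _ (exteriorPower.ιMulti ℂ d (v f)) = _
      rw [detForm_ιMulti, Module.Basis.det_apply]
      have h5 : a.toMatrix (fun k => T i (v f k)) =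
          (Matrix.updateCol (1 : Matrix (Fin d) (Fin d) ℂ) i fun k => β i (f (a k))).transpose := by
        ext j k
        rw [Module.Basis.toMatrix_apply]
        simp only [T, v, LinearMap.add_apply, LinearMap.comp_apply, LinearMap.sub_apply,
          projectionOnto_graphMap, Matrix.transpose_apply,
          Matrix.updateCol_apply, LinearMap.toSpanSingleton_apply, map_add, map_smul,
          Module.Basis.repr_self, Module.Basis.coord_apply, Finsupp.add_apply, Finsupp.smul_apply,
          Finsupp.single_apply, Matrix.one_apply, smul_eq_mul]
        by_cases hij : j = i
        · subst hij
          simp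
        · simp [hij, Ne.symm hij]
      rw [h5, Matrix.det_transpose, ← Matrix.cramer_apply, Matrix.cramer_one]
      rfl

end GrassmannianCharts

/-! ### Affine charts of products -/

section ProductCharts

open FunSpace

lemma continuous_affineSpace {E F : Type*} [AddCommGroup E] [Module ℂ E] [AddCommGroup F]
    [Module ℂ F] (L : E →ₗ[ℂ] F) :
    @Continuous E F (affineSpace E).topology (affineSpace F).topology L := by
  let _ := (affineSpace E).topology
  refine continuous_generateFrom_iff.2 ?_
  rintro _ ⟨p, hp, rfl⟩
  exact isOpen_ofAlgebra (polyFun_comp_mem L hp)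

lemma isRegularAt_affineSpace_comp {E F : Type*} [AddCommGroup E] [Module ℂ E] [AddCommGroup F]
    [Module ℂ F] (L : E →ₗ[ℂ] F) {f : F → ℂ} {x : E} (hf : (affineSpace F).IsRegularAt f (L x)) :
    (affineSpace E).IsRegularAt (fun y => f (L y)) x := by
  obtain ⟨p, hp, q, hq, hx, h⟩ := hf
  refine ⟨_, polyFun_comp_mem L hp, _, polyFun_comp_mem L hq, hx, ?_⟩
  let _ := (affineSpace E).topology
  let _ := (affineSpace F).topology
  exact (continuous_affineSpace L).continuousAt.eventually h

variable {ι : Type u} {X : ι → Type v} {E : ι → Type w} [∀ i, AddCommGroup (E i)]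
  [∀ i, Module ℂ (E i)] {A : ∀ i, FunSpace (X i)} {φ : ∀ i, E i → X i}

/-- The generators pull back to regular functions along the coordinate projections. They need not
become polynomials, since the box U may be smaller than the charts. -/
lemma isRegularAt_prodAlgebra_comp (h : ∀ i, IsChart (A i) (affineSpace (E i)) (φ i))
    {U : ∀ i, Set (X i)} {b : (∀ i, X i) → ℂ} (hb : b ∈ prodAlgebra A U) {x : ∀ i, E i}
    (hx : ∀ i, φ i (x i) ∈ U i) :
    (affineSpace (∀ i, E i)).IsRegularAt (fun y => b fun i => φ i (y i)) x := by
  induction hb using Algebra.adjoin_induction with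
  | mem p hp =>
    obtain ⟨i, g, hg, rfl⟩ := hp
    exact isRegularAt_affineSpace_comp (LinearMap.proj i)
      (f := fun y => g (φ i y)) (((h i).isRegularAt_iff g (x i)).2 (hg _ (hx i)))
  | algebraMap c => exact FunSpace.const _ c x
  | add p q _ _ hp hq => exact FunSpace.add _ hp hq
  | mul p q _ _ hp hq => exact FunSpace.mul _ hp hq

/-- A linear form on a product is a sum of linear forms on the factors; each is extended by zero off
its chart, where values do not matter. -/
lemma exists_prodAlgebra_comp [Finite ι] (h : ∀ i, IsChart (A i) (affineSpace (E i)) (φ i))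
    {p : (∀ i, E i) → ℂ} (hp : p ∈ polyFun (∀ i, E i)) :
    ∃ b ∈ prodAlgebra A fun i => Set.range (φ i), p = fun x => b fun i => φ i (x i) := by
  induction hp using Algebra.adjoin_induction with
  | mem p hp =>
    obtain ⟨ψ, rfl⟩ := hp
    have := Fintype.ofFinite ι
    classical
    let g : ∀ i, X i → ℂ := fun i =>
      Function.extend (φ i) (fun y => (ψ ∘ₗ LinearMap.single ℂ E i) y) 0
    refine ⟨∑ i, fun x => g i (x i), sum_mem fun i _ => Algebra.subset_adjoin ⟨i, g i, ?_, rfl⟩, ?_⟩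
    · rintro _ ⟨y, rfl⟩
      exact (h i).isRegularAt_extend
        (isRegularAt_ofAlgebra (dual_mem_polyFun (ψ ∘ₗ LinearMap.single ℂ E i)) y) 0
    · funext x
      simp only [Finset.sum_apply, g, (h _).injective.extend_apply]
      change ψ x = ∑ i, ψ (Pi.single i (x i))
      rw [← map_sum, Finset.univ_sum_single]
  | algebraMap c => exact ⟨algebraMap ℂ _ c, Subalgebra.algebraMap_mem _ c, rfl⟩
  | add p q _ _ hp hq =>
    obtain ⟨a, ha, rfl⟩ := hp
    obtain ⟨b, hb, rfl⟩ := hq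
    exact ⟨a + b, add_mem ha hb, rfl⟩
  | mul p q _ _ hp hq =>
    obtain ⟨a, ha, rfl⟩ := hp
    obtain ⟨b, hb, rfl⟩ := hq
    exact ⟨a * b, mul_mem ha hb, rfl⟩

/-- A product of affine charts is an affine chart of the product. -/
lemma isChart_pi [Finite ι] (h : ∀ i, IsChart (A i) (affineSpace (E i)) (φ i)) :
    IsChart (FunSpace.prod A) (affineSpace (∀ i, E i)) (fun x i => φ i (x i)) := by
  set Φ : (∀ i, E i) → ∀ i, X i := fun x i => φ i (x i) with hΦ
  have hbox : ∀ {U : ∀ i, Set (X i)}, (∀ i, (A i).topology.IsOpen (U i)) →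
      @IsOpen _ (affineSpace (∀ i, E i)).topology {x | ∀ i, φ i (x i) ∈ U i} := by
    intro U hU
    let _ := (affineSpace (∀ i, E i)).topology
    have : {x : ∀ i, E i | ∀ i, φ i (x i) ∈ U i} = ⋂ i, {x | φ i (x i) ∈ U i} := by
      ext x
      simp
    rw [this]
    refine isOpen_iInter_of_finite fun i => ?_
    let _ := (A i).topology
    let _ := (affineSpace (E i)).topology
    have h1 : IsOpen (φ i ⁻¹' U i) := IsOpen.preimage (h i).isOpenEmbedding.continuous (hU i)
    exact h1.preimage (continuous_affineSpace (LinearMap.proj i))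
  have ht : ((FunSpace.prod A).induced Φ).topology = (affineSpace (∀ i, E i)).topology := by
    apply le_antisymm
    · refine le_generateFrom ?_
      rintro _ ⟨p, hp, rfl⟩
      obtain ⟨b, hb, rfl⟩ := exists_prodAlgebra_comp h hp
      refine ⟨_, TopologicalSpace.isOpen_generateFrom_of_mem
        ⟨fun i => Set.range (φ i), fun i => (h i).isOpen_range, b, hb, rfl⟩, ?_⟩
      ext x
      simp [hΦ]
    · change _ ≤ TopologicalSpace.induced Φ (.generateFrom _)
      rw [induced_generateFrom_eq]
      refine le_generateFrom ?_
      rintro _ ⟨_, ⟨U, hU, b, hb, rfl⟩, rfl⟩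
      let _ := (affineSpace (∀ i, E i)).topology
      rw [isOpen_iff_mem_nhds]
      rintro x ⟨hx, hbx⟩
      filter_upwards [(hbox hU).mem_nhds hx,
        FunSpace.eventually_ne _ (isRegularAt_prodAlgebra_comp h hb hx) hbx] with y h1 h2
      exact ⟨h1, h2⟩
  refine ⟨fun x y hxy => funext fun i => (h i).injective (congrFun hxy i), ?_,
    ext_iff_regular ht fun f x => ?_⟩
  · refine TopologicalSpace.isOpen_generateFrom_of_mem
      ⟨fun i => Set.range (φ i), fun i => (h i).isOpen_range, 1, one_mem _, ?_⟩
    ext y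
    constructor
    · rintro ⟨x, rfl⟩
      exact ⟨fun i => ⟨x i, rfl⟩, one_ne_zero⟩
    · rintro ⟨hy, -⟩
      choose x hx using hy
      exact ⟨x, funext hx⟩
  · constructor
    · rintro ⟨g, ⟨U, hU, hx, a, ha, b, hb, hbx, hg⟩, hf⟩
      refine (affineSpace _).congr ((affineSpace _).mul (isRegularAt_prodAlgebra_comp h ha hx)
        ((affineSpace _).inv (isRegularAt_prodAlgebra_comp h hb hx) hbx)) ?_
      change _ =ᶠ[@nhds _ ((FunSpace.prod A).induced Φ).topology x] _ at hf
      rw [← ht]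
      let _ := (FunSpace.prod A).topology
      let _ := ((FunSpace.prod A).induced Φ).topology
      have hc : Continuous Φ := continuous_induced_dom
      filter_upwards [hf, hc.continuousAt.eventually hg] with y h1 h2
      rw [h1, h2]
      exact (div_eq_mul_inv _ _).symm
    · rintro ⟨p, hp, q, hq, hx, hf⟩
      obtain ⟨a, ha, rfl⟩ := exists_prodAlgebra_comp h hp
      obtain ⟨b, hb, rfl⟩ := exists_prodAlgebra_comp h hq
      refine ⟨fun y => a y / b y, ⟨fun i => Set.range (φ i), fun i => (h i).isOpen_range,
        fun i => ⟨x i, rfl⟩, a, ha, b, hb, hx, Filter.EventuallyEq.rfl⟩, ?_⟩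
      change _ =ᶠ[@nhds _ ((FunSpace.prod A).induced Φ).topology x] _
      rw [ht]
      exact hf

end ProductCharts

/-! ### Common complements of subspaces of equal dimension. -/

lemma Submodule.exists_notMem_of_ne_top {K V : Type*} [Field K] [AddCommGroup V] [Module K V]
    {P Q : Submodule K V} (hP : P ≠ ⊤) (hQ : Q ≠ ⊤) : ∃ x, x ∉ P ∧ x ∉ Q := by
  obtain ⟨x, -, hx⟩ := SetLike.exists_of_lt hP.lt_top
  obtain ⟨y, -, hy⟩ := SetLike.exists_of_lt hQ.lt_top
  by_cases hxQ : x ∈ Q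
  · by_cases hyP : y ∈ P
    · exact ⟨x + y, fun h => hx ((P.add_mem_iff_left hyP).1 h),
        fun h => hy ((Q.add_mem_iff_right hxQ).1 h)⟩
    · exact ⟨y, hyP, hy⟩
  · exact ⟨x, hx, hxQ⟩

/-- Two subspaces of the same dimension have a common complement. -/
lemma Submodule.exists_common_isCompl {K V : Type*} [Field K] [AddCommGroup V] [Module K V]
    [FiniteDimensional K V] {P Q : Submodule K V} (h : Module.finrank K P = Module.finrank K Q) :
    ∃ R, IsCompl P R ∧ IsCompl Q R := by
  obtain ⟨m, hm⟩ : ∃ m, Module.finrank K P + m = Module.finrank K V :=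
    ⟨_, Nat.add_sub_cancel' P.finrank_le⟩
  -- Induction on the codimension: a vector x outside P and Q is added to both, and a common
  -- complement R of the enlarged spaces yields the complement Kx + R of the original ones.
  induction m generalizing P Q with
  | zero =>
    have h1 : P = ⊤ := Submodule.eq_top_of_finrank_eq (by simpa using hm)
    have h2 : Q = ⊤ := Submodule.eq_top_of_finrank_eq (by rw [← h]; simpa using hm)
    subst h1 h2
    exact ⟨⊥, isCompl_top_bot, isCompl_top_bot⟩
  | succ m ih =>
    have hne : ∀ {T : Submodule K V}, Module.finrank K T + (m + 1) = Module.finrank K V →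
        T ≠ ⊤ := by
      rintro T hT rfl
      rw [finrank_top] at hT
      omega
    obtain ⟨x, hxP, hxQ⟩ := Submodule.exists_notMem_of_ne_top (hne hm) (hne (by rwa [← h]))
    have hx0 : x ≠ 0 := fun h0 => hxP (h0 ▸ P.zero_mem)
    have hs := finrank_span_singleton (K := K) hx0
    have hdim : ∀ {T : Submodule K V}, x ∉ T →
        Module.finrank K ↥(T ⊔ K ∙ x) = Module.finrank K T + 1 := by
      intro T hT
      have h1 := Submodule.finrank_sup_add_finrank_inf_eq T (K ∙ x)
      have h2 : T ⊓ K ∙ x = ⊥ := by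
        rw [← disjoint_iff]
        exact (Submodule.disjoint_span_singleton' hx0).2 hT
      rw [h2, finrank_bot, hs] at h1
      omega
    obtain ⟨R, hR1, hR2⟩ := ih (P := P ⊔ K ∙ x) (Q := Q ⊔ K ∙ x)
      (by rw [hdim hxP, hdim hxQ, h]) (by rw [hdim hxP]; omega)
    have key : ∀ {T : Submodule K V}, x ∉ T → IsCompl (T ⊔ K ∙ x) R →
        IsCompl T ((K ∙ x) ⊔ R) := by
      intro T hT hTR
      have hc : T ⊔ ((K ∙ x) ⊔ R) = ⊤ := by rw [← sup_assoc, hTR.sup_eq_top]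
      refine ⟨?_, codisjoint_iff.2 hc⟩
      have h1 := Submodule.finrank_sup_add_finrank_inf_eq T ((K ∙ x) ⊔ R)
      have h2 := Submodule.finrank_add_le_finrank_add_finrank (K ∙ x) R
      have h3 := Submodule.finrank_add_eq_of_isCompl hTR
      rw [hdim hT] at h3
      rw [hc, finrank_top] at h1
      rw [disjoint_iff, ← Submodule.finrank_eq_zero (R := K)]
      omega
    exact ⟨_, key hxP hR1, key hxQ hR2⟩

/-! ### Multiplicities of irreducible representations -/

section Multiplicities

variable {𝔤 : Type u} [LieRing 𝔤]

section Schur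

variable {M N : Type*} [AddCommGroup M] [Module ℂ M] [LieRingModule 𝔤 M]
  [AddCommGroup N] [Module ℂ N] [LieRingModule 𝔤 N]

lemma LieModule.IsIrreducible.nontrivial_of_isIrreducible (h : LieModule.IsIrreducible ℂ 𝔤 M) :
    Nontrivial M := by
  by_contra hn
  rw [not_nontrivial_iff_subsingleton] at hn
  refine bot_ne_top (α := LieSubmodule ℂ 𝔤 M) ?_
  ext x
  simp [Subsingleton.elim x 0]

/-- Schur's lemma: a morphism between non-isomorphic irreducible modules is zero. -/
lemma LieModuleHom.eq_zero_of_isEmpty_equiv (hM : LieModule.IsIrreducible ℂ 𝔤 M)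
    (hN : LieModule.IsIrreducible ℂ 𝔤 N) (h : IsEmpty (M ≃ₗ⁅ℂ,𝔤⁆ N)) (f : M →ₗ⁅ℂ,𝔤⁆ N) :
    f = 0 := by
  rcases eq_bot_or_eq_top f.ker with hk | hk
  · rcases eq_bot_or_eq_top f.range with hr | hr
    · ext x
      have : f x ∈ f.range := ⟨x, rfl⟩
      rw [hr] at this
      simpa using this
    · rw [LieModuleHom.ker_eq_bot] at hk
      rw [LieModuleHom.range_eq_top] at hr
      let e := Equiv.ofBijective f ⟨hk, hr⟩
      exact (h.false { f with
        invFun := e.symm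
        left_inv := e.left_inv
        right_inv := e.right_inv }).elim
  · ext x
    have : x ∈ f.ker := by
      rw [hk]
      trivial
    simpa using this

end Schur

variable [LieAlgebra ℂ 𝔤]

section Schur

variable {M N : Type*} [AddCommGroup M] [Module ℂ M] [LieRingModule 𝔤 M] [LieModule ℂ 𝔤 M]
  [AddCommGroup N] [Module ℂ N] [LieRingModule 𝔤 N] [LieModule ℂ 𝔤 N]

instance [FiniteDimensional ℂ M] [FiniteDimensional ℂ N] :
    FiniteDimensional ℂ (M →ₗ⁅ℂ,𝔤⁆ N) := by
  let F : (M →ₗ⁅ℂ,𝔤⁆ N) →ₗ[ℂ] (M →ₗ[ℂ] N) :=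
    { toFun := fun f => f
      map_add' := fun _ _ => rfl
      map_smul' := fun _ _ => rfl }
  refine FiniteDimensional.of_injective F fun f g h => ?_
  ext x
  exact LinearMap.congr_fun h x

/-- Schur's lemma: an endomorphism of an irreducible module is a scalar. -/
lemma LieModuleHom.exists_eq_smul [FiniteDimensional ℂ M] (hM : LieModule.IsIrreducible ℂ 𝔤 M)
    (f : M →ₗ⁅ℂ,𝔤⁆ M) : ∃ c : ℂ, f = c • LieModuleHom.id := by
  have := hM.nontrivial_of_isIrreducible
  obtain ⟨c, hc⟩ := Module.End.exists_eigenvalue (f : M →ₗ[ℂ] M)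
  obtain ⟨x, hx⟩ := hc.exists_hasEigenvector
  refine ⟨c, ?_⟩
  rcases eq_bot_or_eq_top (f - c • LieModuleHom.id).ker with hk | hk
  · have h1 : x ∈ (f - c • LieModuleHom.id).ker := by
      have h2 : f x = c • x := hx.apply_eq_smul
      simp [h2]
    rw [hk] at h1
    exact (hx.2 (by simpa using h1)).elim
  · ext y
    have h1 : y ∈ (f - c • LieModuleHom.id).ker := by
      rw [hk]
      trivial
    simpa [sub_eq_zero] using h1

lemma LieModuleHom.finrank_end [FiniteDimensional ℂ M] (hM : LieModule.IsIrreducible ℂ 𝔤 M) :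
    Module.finrank ℂ (M →ₗ⁅ℂ,𝔤⁆ M) = 1 := by
  have := hM.nontrivial_of_isIrreducible
  refine finrank_eq_one (LieModuleHom.id : M →ₗ⁅ℂ,𝔤⁆ M) (fun h => ?_) fun f => ?_
  · obtain ⟨x, hx⟩ := exists_ne (0 : M)
    exact hx (LieModuleHom.congr_fun h x)
  · obtain ⟨c, hc⟩ := f.exists_eq_smul hM
    exact ⟨c, hc.symm⟩

end Schur

/-! ### Multiplicities extracted from classes in the representation ring. -/

section RepresentationRing

/-- A numerical invariant of representations that is additive on direct sums factors through the
representation ring. -/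
lemma exists_repRing_hom (g : LieRep.{u, w} 𝔤 → ℤ)
    (hg : ∀ (V W U : LieRep.{u, w} 𝔤) (i : W.carrier →ₗ⁅ℂ,𝔤⁆ V.carrier)
      (j : U.carrier →ₗ⁅ℂ,𝔤⁆ V.carrier),
      Function.Bijective (fun p : W.carrier × U.carrier => i p.1 + j p.2) → g V = g W + g U) :
    ∃ G : RepRing.{u, w} 𝔤 →+ ℤ, ∀ V : LieRep.{u, w} 𝔤,
      G (QuotientAddGroup.mk (FreeAbelianGroup.of V)) = g V := by
  refine ⟨QuotientAddGroup.lift _ (FreeAbelianGroup.lift g) ?_, fun V => ?_⟩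
  · rw [repRelations, AddSubgroup.closure_le]
    rintro _ ⟨V, W, U, i, j, hij, rfl⟩
    change FreeAbelianGroup.lift g _ = 0
    simp only [map_sub, map_add, FreeAbelianGroup.lift_apply_of]
    rw [hg V W U i j hij, sub_self]
  · simp

variable {V : Type w} [AddCommGroup V] [Module ℂ V] [LieRingModule 𝔤 V] [LieModule ℂ 𝔤 V]
  [FiniteDimensional ℂ V] {k : ℕ} {W : Fin k → Type w} [∀ i, AddCommGroup (W i)]
  [∀ i, Module ℂ (W i)] [∀ i, LieRingModule 𝔤 (W i)] [∀ i, LieModule ℂ 𝔤 (W i)]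
  [∀ i, FiniteDimensional ℂ (W i)] {n : Fin k → ℕ}

/-- Dimensions add in a direct sum decomposition. -/
lemma finrank_add_of_bijective {P Q R : Type*} [AddCommGroup P] [Module ℂ P]
    [FiniteDimensional ℂ P] [AddCommGroup Q] [Module ℂ Q] [FiniteDimensional ℂ Q]
    [AddCommGroup R] [Module ℂ R] (i : P →ₗ[ℂ] R) (j : Q →ₗ[ℂ] R)
    (h : Function.Bijective fun p : P × Q => i p.1 + j p.2) :
    Module.finrank ℂ R = Module.finrank ℂ P + Module.finrank ℂ Q := by
  rw [← Module.finrank_prod]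
  exact (LinearEquiv.ofBijective (i.coprod j) h).finrank_eq.symm

lemma finrank_eq_of_cl_eq (h : cl 𝔤 V = ∑ i, n i • cl 𝔤 (W i)) :
    Module.finrank ℂ V = ∑ i, n i * Module.finrank ℂ (W i) := by
  obtain ⟨G, hG⟩ := exists_repRing_hom (𝔤 := 𝔤) (fun X : LieRep.{u, w} 𝔤 =>
    (Module.finrank ℂ X.carrier : ℤ)) (fun X Y Z i j hij => by
      exact_mod_cast finrank_add_of_bijective i.toLinearMap j.toLinearMap hij)
  have h1 := congrArg G h
  simp only [map_sum, map_nsmul, cl, hG, nsmul_eq_mul] at h1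
  exact_mod_cast h1

/-- Hom(M, -) preserves direct sums, so its dimension is an additive invariant and can be evaluated
on the class equation. -/
lemma finrank_hom_eq_of_cl_eq (M : Type*) [AddCommGroup M] [Module ℂ M] [LieRingModule 𝔤 M]
    [LieModule ℂ 𝔤 M] [FiniteDimensional ℂ M] (h : cl 𝔤 V = ∑ i, n i • cl 𝔤 (W i)) :
    Module.finrank ℂ (M →ₗ⁅ℂ,𝔤⁆ V) = ∑ i, n i * Module.finrank ℂ (M →ₗ⁅ℂ,𝔤⁆ W i) := by
  obtain ⟨G, hG⟩ := exists_repRing_hom (𝔤 := 𝔤) (fun X : LieRep.{u, w} 𝔤 =>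
    (Module.finrank ℂ (M →ₗ⁅ℂ,𝔤⁆ X.carrier) : ℤ)) (fun X Y Z i j hij => by
      let post : ∀ {A B : LieRep.{u, w} 𝔤} (f : A.carrier →ₗ⁅ℂ,𝔤⁆ B.carrier),
          (M →ₗ⁅ℂ,𝔤⁆ A.carrier) →ₗ[ℂ] (M →ₗ⁅ℂ,𝔤⁆ B.carrier) := fun f =>
        { toFun := fun a => f.comp a
          map_add' := fun a b => by ext x; simp
          map_smul' := fun c a => by ext x; simp }
      have hadd := finrank_add_of_bijective (post i) (post j) ⟨?_, ?_⟩
      · exact_mod_cast hadd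
      · rintro ⟨a, b⟩ ⟨a', b'⟩ hab
        have h2 : ∀ x, a x = a' x ∧ b x = b' x := fun x =>
          Prod.ext_iff.1 (hij.1 (a₁ := (a x, b x)) (a₂ := (a' x, b' x))
            (LieModuleHom.congr_fun hab x))
        exact Prod.ext (LieModuleHom.ext fun x => (h2 x).1) (LieModuleHom.ext fun x => (h2 x).2)
      · intro c
        let e := LinearEquiv.ofBijective (i.toLinearMap.coprod j.toLinearMap) hij
        have he : ∀ p : Y.carrier × Z.carrier, e p = i p.1 + j p.2 := fun p => rfl
        -- The inverse of the direct sum isomorphism is equivariant, so the two components of c are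
        -- again morphisms.
        have hlie : ∀ (x : 𝔤) (y : X.carrier),
            e.symm ⁅x, y⁆ = (⁅x, (e.symm y).1⁆, ⁅x, (e.symm y).2⁆) := by
          intro x y
          rw [LinearEquiv.symm_apply_eq, he]
          rw [LieModuleHom.map_lie, LieModuleHom.map_lie, ← lie_add, ← he (e.symm y),
            LinearEquiv.apply_symm_apply]
        refine ⟨⟨⟨LinearMap.fst ℂ _ _ ∘ₗ e.symm.toLinearMap ∘ₗ c.toLinearMap, ?_⟩,
          ⟨LinearMap.snd ℂ _ _ ∘ₗ e.symm.toLinearMap ∘ₗ c.toLinearMap, ?_⟩⟩, ?_⟩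
        · intro x m
          change (e.symm (c ⁅x, m⁆)).1 = _
          rw [LieModuleHom.map_lie, hlie]
          rfl
        · intro x m
          change (e.symm (c ⁅x, m⁆)).2 = _
          rw [LieModuleHom.map_lie, hlie]
          rfl
        · ext m
          change i (e.symm (c m)).1 + j (e.symm (c m)).2 = c m
          rw [← he, LinearEquiv.apply_symm_apply])
  have h1 := congrArg G h
  simp only [map_sum, map_nsmul, cl, hG, nsmul_eq_mul] at h1
  exact_mod_cast h1

/-- By Schur's lemma only the i-th summand contributes, and End(W_i) is one-dimensional. -/
lemma finrank_hom_irreducible_of_cl_eq (hirr : ∀ i, LieModule.IsIrreducible ℂ 𝔤 (W i))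
    (hdist : ∀ i j, i ≠ j → IsEmpty (W i ≃ₗ⁅ℂ,𝔤⁆ W j))
    (h : cl 𝔤 V = ∑ i, n i • cl 𝔤 (W i)) (i : Fin k) :
    Module.finrank ℂ (W i →ₗ⁅ℂ,𝔤⁆ V) = n i := by
  rw [finrank_hom_eq_of_cl_eq (W i) h, Finset.sum_eq_single i]
  · rw [LieModuleHom.finrank_end (hirr i), mul_one]
  · intro j _ hj
    have : Subsingleton (W i →ₗ⁅ℂ,𝔤⁆ W j) := ⟨fun f g => by
      rw [f.eq_zero_of_isEmpty_equiv (hirr i) (hirr j) (hdist i j hj.symm),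
        g.eq_zero_of_isEmpty_equiv (hirr i) (hirr j) (hdist i j hj.symm)]⟩
    rw [Module.finrank_zero_of_subsingleton, mul_zero]
  · simp

/-- The relations speak only of direct sums, so an isomorphism is read as V ≅ V' ⊕ 0. The class of 0
cancels against the same relation for the identity of V. -/
lemma cl_congr {V' : Type w} [AddCommGroup V'] [Module ℂ V'] [LieRingModule 𝔤 V']
    [LieModule ℂ 𝔤 V'] [FiniteDimensional ℂ V'] (e : V' ≃ₗ⁅ℂ,𝔤⁆ V) : cl 𝔤 V' = cl 𝔤 V := by
  have key : ∀ {X Y : Type w} [AddCommGroup X] [Module ℂ X] [LieRingModule 𝔤 X] [LieModule ℂ 𝔤 X]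
      [FiniteDimensional ℂ X] [AddCommGroup Y] [Module ℂ Y] [LieRingModule 𝔤 Y] [LieModule ℂ 𝔤 Y]
      [FiniteDimensional ℂ Y] (f : Y ≃ₗ⁅ℂ,𝔤⁆ X),
      cl 𝔤 X = cl 𝔤 Y + cl 𝔤 (⊥ : LieSubmodule ℂ 𝔤 V) := by
    intro X Y _ _ _ _ _ _ _ _ _ _ f
    rw [← sub_eq_zero]
    refine (QuotientAddGroup.eq_zero_iff _).2 (AddSubgroup.subset_closure
      ⟨LieRep.mk X, LieRep.mk Y, LieRep.mk (⊥ : LieSubmodule ℂ 𝔤 V), f.toLieModuleHom, 0, ?_, rfl⟩)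
    constructor
    · rintro ⟨a, b⟩ ⟨a', b'⟩ hab
      have h1 : f a = f a' := by simpa using hab
      exact Prod.ext (f.injective h1) (Subsingleton.elim b b')
    · intro x
      exact ⟨(f.symm x, 0), by simp⟩
  have h1 := key e
  rw [key (LieModuleEquiv.refl : V ≃ₗ⁅ℂ,𝔤⁆ V)] at h1
  exact (add_right_cancel h1).symm

end RepresentationRing

section Independence

variable {V : Type*} [AddCommGroup V] [Module ℂ V] [LieRingModule 𝔤 V] [LieModule ℂ 𝔤 V]
  {k : ℕ} {W : Fin k → Type*} [∀ i, AddCommGroup (W i)]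
  [∀ i, Module ℂ (W i)] [∀ i, LieRingModule 𝔤 (W i)] [∀ i, LieModule ℂ 𝔤 (W i)]
  [∀ i, FiniteDimensional ℂ (W i)]

/-- Linearly independent morphisms from pairwise non-isomorphic irreducible modules embed the
direct sum of these modules. -/
lemma eq_zero_of_sum_irreducible_eq_zero (hirr : ∀ i, LieModule.IsIrreducible ℂ 𝔤 (W i))
    (hdist : ∀ i j, i ≠ j → IsEmpty (W i ≃ₗ⁅ℂ,𝔤⁆ W j)) {κ : Fin k → Type*}
    {m : ∀ i, κ i → (W i →ₗ⁅ℂ,𝔤⁆ V)} (hm : ∀ i, LinearIndependent ℂ (m i))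
    (s : Finset (Σ i, κ i)) (x : ∀ t : Σ i, κ i, W t.1)
    (hx : ∑ t ∈ s, m t.1 t.2 (x t) = 0) : ∀ t ∈ s, x t = 0 := by
  classical
  induction s using Finset.induction_on generalizing x with
  | empty => simp
  | insert t₀ s ht₀ ih =>
    rw [Finset.sum_insert ht₀] at hx
    -- N is the preimage under the new morphism of the sum of the images of the others, so it is
    -- zero or everything. If zero, x t₀ vanishes and induction applies; if everything, the new
    -- morphism factors through the others.
    let N : LieSubmodule ℂ 𝔤 (W t₀.1) :=
      { carrier := {y | ∃ z : ∀ t : Σ i, κ i, W t.1, ∑ t ∈ s, m t.1 t.2 (z t) = m t₀.1 t₀.2 y}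
        zero_mem' := ⟨0, by simp⟩
        add_mem' := by
          rintro a b ⟨z, hz⟩ ⟨z', hz'⟩
          exact ⟨z + z', by simp [Finset.sum_add_distrib, hz, hz']⟩
        smul_mem' := by
          rintro c a ⟨z, hz⟩
          exact ⟨c • z, by simp [← Finset.smul_sum, hz]⟩
        lie_mem := by
          rintro g a ⟨z, hz⟩
          exact ⟨fun t => ⁅g, z t⁆, by simp [← lie_sum, hz]⟩ }
    have := hirr t₀.1
    rcases eq_bot_or_eq_top N with hN | hN
    · have h1 : x t₀ ∈ N := ⟨-x, by
        simp only [Pi.neg_apply, map_neg, Finset.sum_neg_distrib]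
        exact (eq_neg_of_add_eq_zero_left hx).symm⟩
      rw [hN, LieSubmodule.mem_bot] at h1
      rw [h1, map_zero, zero_add] at hx
      intro t ht
      rcases Finset.mem_insert.1 ht with rfl | ht
      · exact h1
      · exact ih x hx t ht
    · exfalso
      have hex : ∀ y, ∃ z : ∀ t : Σ i, κ i, W t.1,
          ∑ t ∈ s, m t.1 t.2 (z t) = m t₀.1 t₀.2 y := fun y => by
        have : y ∈ N := by
          rw [hN]
          trivial
        exact this
      choose z hz using hex
      have huniq : ∀ y (z' : ∀ t : Σ i, κ i, W t.1),
          ∑ t ∈ s, m t.1 t.2 (z' t) = m t₀.1 t₀.2 y → ∀ t ∈ s, z y t = z' t := by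
        intro y z' hz' t ht
        have h2 := ih (z y - z') (by simp [Finset.sum_sub_distrib, hz, hz']) t ht
        exact sub_eq_zero.1 h2
      -- The induction hypothesis makes the chosen preimages unique on s, hence linear and
      -- equivariant in y.
      let f : ∀ t ∈ s, W t₀.1 →ₗ⁅ℂ,𝔤⁆ W t.1 := fun t ht =>
        { toFun := fun y => z y t
          map_add' := fun a b => huniq _ (z a + z b) (by simp [Finset.sum_add_distrib, hz]) t ht
          map_smul' := fun c a => huniq _ (c • z a) (by simp [← Finset.smul_sum, hz]) t ht
          map_lie' := fun {g a} =>
            huniq _ (fun t => ⁅g, z a t⁆) (by simp [← lie_sum, hz]) t ht }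
      have hsum : m t₀.1 t₀.2 = ∑ t ∈ s.attach, (m t.1.1 t.1.2).comp (f t.1 t.2) := by
        ext y
        have h3 : ∀ (a : Finset {t // t ∈ s}),
            (∑ t ∈ a, (m t.1.1 t.1.2).comp (f t.1 t.2)) y =
              ∑ t ∈ a, m t.1.1 t.1.2 (z y t.1) := by
          intro a
          induction a using Finset.induction_on with
          | empty => simp
          | insert b a hb ih' =>
            rw [Finset.sum_insert hb, Finset.sum_insert hb, LieModuleHom.add_apply, ih']
            rfl
        rw [h3, ← hz y, ← Finset.sum_attach]
      -- By Schur's lemma the components between different types vanish and those within one type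
      -- are scalars. The new morphism is then a combination of others of its type, against linear
      -- independence.
      have hmem : m t₀.1 t₀.2 ∈ Submodule.span ℂ (m t₀.1 '' {t₀.2}ᶜ) := by
        rw [hsum]
        refine Submodule.sum_mem _ ?_
        rintro ⟨⟨i, j⟩, ht⟩ _
        by_cases hi : t₀.1 = i
        · subst hi
          obtain ⟨c, hc⟩ := (f ⟨t₀.1, j⟩ ht).exists_eq_smul (hirr _)
          have h4 : (m t₀.1 j).comp (f ⟨t₀.1, j⟩ ht) = c • m t₀.1 j := by
            rw [hc]
            ext y
            simp
          rw [h4]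
          refine Submodule.smul_mem _ _ (Submodule.subset_span ⟨j, ?_, rfl⟩)
          rintro rfl
          exact ht₀ ht
        · have h5 := (f ⟨i, j⟩ ht).eq_zero_of_isEmpty_equiv (hirr _) (hirr _) (hdist _ _ hi)
          have h4 : (m i j).comp (f ⟨i, j⟩ ht) = 0 := by
            rw [h5]
            ext y
            simp
          rw [h4]
          exact Submodule.zero_mem _
      exact (hm t₀.1).notMem_span_image (by simp) hmem

end Independence

end Multiplicities

/-! ### Isotypic decompositions -/

section Isotypic

variable {𝔤 : Type u} [LieRing 𝔤]

section SumMap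

variable {V : Type*} [AddCommGroup V] [Module ℂ V] [LieRingModule 𝔤 V]
  {k : ℕ} {W : Fin k → Type*} [∀ i, AddCommGroup (W i)]
  [∀ i, Module ℂ (W i)] [∀ i, LieRingModule 𝔤 (W i)] {n : Fin k → ℕ}

/-- The sum `⨁ i, (W i) ^ (n i) → V` of a family of morphisms `W i → V`. -/
def homSum (m : ∀ i, Fin (n i) → (W i →ₗ⁅ℂ,𝔤⁆ V)) : (∀ i, Fin (n i) → W i) →ₗ[ℂ] V where
  toFun x := ∑ i, ∑ j, m i j (x i j)
  map_add' x y := by simp [Finset.sum_add_distrib]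
  map_smul' c x := by simp [Finset.smul_sum]

lemma homSum_apply (m : ∀ i, Fin (n i) → (W i →ₗ⁅ℂ,𝔤⁆ V)) (x : ∀ i, Fin (n i) → W i) :
    homSum m x = ∑ i, ∑ j, m i j (x i j) := rfl

lemma homSum_lie (m : ∀ i, Fin (n i) → (W i →ₗ⁅ℂ,𝔤⁆ V)) (g : 𝔤) (x : ∀ i, Fin (n i) → W i) :
    homSum m (fun i j => ⁅g, x i j⁆) = ⁅g, homSum m x⁆ := by
  simp [homSum_apply, lie_sum]

variable [LieAlgebra ℂ 𝔤]

lemma homSum_injective [LieModule ℂ 𝔤 V] [∀ i, LieModule ℂ 𝔤 (W i)] [∀ i, FiniteDimensional ℂ (W i)]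
    (hirr : ∀ i, LieModule.IsIrreducible ℂ 𝔤 (W i))
    (hdist : ∀ i j, i ≠ j → IsEmpty (W i ≃ₗ⁅ℂ,𝔤⁆ W j))
    {m : ∀ i, Fin (n i) → (W i →ₗ⁅ℂ,𝔤⁆ V)} (hm : ∀ i, LinearIndependent ℂ (m i)) :
    Function.Injective (homSum m) := by
  refine (injective_iff_map_eq_zero _).2 fun x hx => ?_
  have h := eq_zero_of_sum_irreducible_eq_zero hirr hdist hm Finset.univ (fun t => x t.1 t.2) (by
    rw [Fintype.sum_sigma]
    exact hx)
  funext i j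
  exact h ⟨i, j⟩ (Finset.mem_univ _)

end SumMap

variable [LieAlgebra ℂ 𝔤]

/-- Injectivity comes from linear independence, and the class equation makes the two dimensions
equal. -/
lemma homSum_bijective_of_cl_eq {V : Type w} [AddCommGroup V] [Module ℂ V] [LieRingModule 𝔤 V]
    [LieModule ℂ 𝔤 V] [FiniteDimensional ℂ V] {k : ℕ} {W : Fin k → Type w}
    [∀ i, AddCommGroup (W i)] [∀ i, Module ℂ (W i)] [∀ i, LieRingModule 𝔤 (W i)]
    [∀ i, LieModule ℂ 𝔤 (W i)] [∀ i, FiniteDimensional ℂ (W i)] {n : Fin k → ℕ}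
    (hirr : ∀ i, LieModule.IsIrreducible ℂ 𝔤 (W i))
    (hdist : ∀ i j, i ≠ j → IsEmpty (W i ≃ₗ⁅ℂ,𝔤⁆ W j))
    (h : cl 𝔤 V = ∑ i, n i • cl 𝔤 (W i))
    {m : ∀ i, Fin (n i) → (W i →ₗ⁅ℂ,𝔤⁆ V)} (hm : ∀ i, LinearIndependent ℂ (m i)) :
    Function.Bijective (homSum m) := by
  have hi := homSum_injective hirr hdist hm
  refine ⟨hi, ?_⟩
  refine (LinearMap.injective_iff_surjective_of_finrank_eq_finrank ?_).1 hi
  rw [finrank_eq_of_cl_eq h, Module.finrank_pi_fintype]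
  simp [Module.finrank_pi_fintype]

variable (𝔤)

/-- A decomposition `V ≅ ⨁ i, ℂ ^ (n i) ⊗ W i` of a module, in terms of the morphisms `W i → V`
attached to the vectors of `ℂ ^ (n i)` and the coordinate projections `V → W i`. -/
structure IsotypicDecomposition (V : Type*) [AddCommGroup V] [Module ℂ V] [LieRingModule 𝔤 V]
    [LieModule ℂ 𝔤 V] {k : ℕ} (W : Fin k → Type*) [∀ i, AddCommGroup (W i)]
    [∀ i, Module ℂ (W i)] [∀ i, LieRingModule 𝔤 (W i)] [∀ i, LieModule ℂ 𝔤 (W i)]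
    (n : Fin k → ℕ) where
  /-- the morphism attached to a vector -/
  toHom : ∀ i, (Fin (n i) → ℂ) ≃ₗ[ℂ] (W i →ₗ⁅ℂ,𝔤⁆ V)
  /-- the coordinate projections -/
  coord : ∀ i, Fin (n i) → (V →ₗ⁅ℂ,𝔤⁆ W i)
  coord_toHom : ∀ i j p x, coord i j (toHom i p x) = p j • x
  coord_toHom_of_ne : ∀ i i' j p x, i ≠ i' → coord i j (toHom i' p x) = 0
  sum_toHom_coord : ∀ v, ∑ i, ∑ j, toHom i (Pi.single j 1) (coord i j v) = v

variable {𝔤}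

lemma nonempty_isotypicDecomposition {V : Type w} [AddCommGroup V] [Module ℂ V]
    [LieRingModule 𝔤 V] [LieModule ℂ 𝔤 V] [FiniteDimensional ℂ V] {k : ℕ} {W : Fin k → Type w}
    [∀ i, AddCommGroup (W i)] [∀ i, Module ℂ (W i)] [∀ i, LieRingModule 𝔤 (W i)]
    [∀ i, LieModule ℂ 𝔤 (W i)] [∀ i, FiniteDimensional ℂ (W i)] {n : Fin k → ℕ}
    (hirr : ∀ i, LieModule.IsIrreducible ℂ 𝔤 (W i))
    (hdist : ∀ i j, i ≠ j → IsEmpty (W i ≃ₗ⁅ℂ,𝔤⁆ W j))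
    (h : cl 𝔤 V = ∑ i, n i • cl 𝔤 (W i)) : Nonempty (IsotypicDecomposition 𝔤 V W n) := by
  let b : ∀ i, Module.Basis (Fin (n i)) ℂ (W i →ₗ⁅ℂ,𝔤⁆ V) := fun i =>
    Module.finBasisOfFinrankEq ℂ _ (finrank_hom_irreducible_of_cl_eq hirr hdist h i)
  let m : ∀ i, Fin (n i) → (W i →ₗ⁅ℂ,𝔤⁆ V) := fun i j => b i j
  have hm := homSum_bijective_of_cl_eq hirr hdist h (m := m) fun i => (b i).linearIndependent
  let e := LinearEquiv.ofBijective (homSum m) hm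
  have he : ∀ x, e.symm (homSum m x) = x := e.symm_apply_apply
  have he' : ∀ v, homSum m (e.symm v) = v := e.apply_symm_apply
  have hlie : ∀ (g : 𝔤) v i j, e.symm ⁅g, v⁆ i j = ⁅g, e.symm v i j⁆ := by
    intro g v i j
    conv_lhs => rw [← he' v, ← homSum_lie, he]
  have hb : ∀ i (p : Fin (n i) → ℂ) (x : W i), (b i).equivFun.symm p x =
      homSum m (Pi.single i fun j => p j • x) := by
    intro i p x
    rw [homSum_apply, Finset.sum_eq_single i]
    · rw [Module.Basis.equivFun_symm_apply]
      let ev : (W i →ₗ⁅ℂ,𝔤⁆ V) →ₗ[ℂ] V :=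
        { toFun := fun f => f x
          map_add' := fun _ _ => rfl
          map_smul' := fun _ _ => rfl }
      change ev _ = _
      simp [ev, m]
    · intro i' _ hi'
      simp [Pi.single_eq_of_ne hi']
    · simp
  refine ⟨{
    toHom := fun i => (b i).equivFun.symm
    coord := fun i j => ⟨LinearMap.proj j ∘ₗ LinearMap.proj i ∘ₗ e.symm.toLinearMap,
      fun {g v} => hlie g v i j⟩
    coord_toHom := fun i j p x => ?_
    coord_toHom_of_ne := fun i i' j p x hne => ?_
    sum_toHom_coord := fun v => ?_ }⟩
  · change e.symm ((b i).equivFun.symm p x) i j = _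
    rw [hb, he]
    simp
  · change e.symm ((b i').equivFun.symm p x) i j = _
    rw [hb, he]
    simp [Pi.single_eq_of_ne hne]
  · change ∑ i, ∑ j, (b i).equivFun.symm (Pi.single j 1) (e.symm v i j) = v
    conv_rhs => rw [← he' v, homSum_apply]
    simp [m, Module.Basis.equivFun_symm_apply, Pi.single_apply, ite_smul]

namespace IsotypicDecomposition

variable {V : Type*} [AddCommGroup V] [Module ℂ V] [LieRingModule 𝔤 V] [LieModule ℂ 𝔤 V]
  {k : ℕ} {W : Fin k → Type*} [∀ i, AddCommGroup (W i)]
  [∀ i, Module ℂ (W i)] [∀ i, LieRingModule 𝔤 (W i)] [∀ i, LieModule ℂ 𝔤 (W i)]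
  {n : Fin k → ℕ} (D : IsotypicDecomposition 𝔤 V W n)

/-- The endomorphism of `V` given by endomorphisms of the multiplicity spaces. -/
def endo : (∀ i, (Fin (n i) → ℂ) →ₗ[ℂ] (Fin (n i) → ℂ)) →ₗ[ℂ] (V →ₗ[ℂ] V) where
  toFun T := ∑ i, ∑ j, (D.toHom i (T i (Pi.single j 1))).toLinearMap ∘ₗ (D.coord i j).toLinearMap
  map_add' T T' := by
    ext v
    simp [Finset.sum_add_distrib]
  map_smul' c T := by
    ext v
    simp [Finset.smul_sum]

lemma endo_apply (T : ∀ i, (Fin (n i) → ℂ) →ₗ[ℂ] (Fin (n i) → ℂ)) (v : V) :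
    D.endo T v = ∑ i, ∑ j, D.toHom i (T i (Pi.single j 1)) (D.coord i j v) := by
  simp [endo]

/-- With `toHom i p x` read as p ⊗ x, `endo T` is ⨁ T_i ⊗ id; the computation expands p in the
standard basis. -/
lemma endo_toHom (T : ∀ i, (Fin (n i) → ℂ) →ₗ[ℂ] (Fin (n i) → ℂ)) (i : Fin k)
    (p : Fin (n i) → ℂ) (x : W i) : D.endo T (D.toHom i p x) = D.toHom i (T i p) x := by
  rw [endo_apply, Finset.sum_eq_single i]
  · simp only [D.coord_toHom, map_smul]
    let ev : (Fin (n i) → ℂ) →ₗ[ℂ] V :=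
      { toFun := fun q => D.toHom i (T i q) x
        map_add' := fun a b => by simp
        map_smul' := fun c a => by simp }
    have hp : p = ∑ j, p j • Pi.single j (1 : ℂ) := by
      ext j
      simp [Finset.sum_apply, Pi.single_apply]
    change _ = ev p
    conv_rhs => rw [hp, map_sum]
    exact Finset.sum_congr rfl fun j _ => (map_smul ev _ _).symm
  · intro i' _ hi'
    simp [D.coord_toHom_of_ne i' i _ p x hi']
  · simp

lemma endo_lie (T : ∀ i, (Fin (n i) → ℂ) →ₗ[ℂ] (Fin (n i) → ℂ)) (g : 𝔤) (v : V) :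
    D.endo T ⁅g, v⁆ = ⁅g, D.endo T v⁆ := by
  simp [endo_apply, lie_sum]

lemma eq_top_of_forall_toHom_mem {N : Submodule ℂ V} (h : ∀ i p x, D.toHom i p x ∈ N) :
    N = ⊤ := by
  rw [eq_top_iff]
  intro v _
  rw [← D.sum_toHom_coord v]
  exact sum_mem fun i _ => sum_mem fun j _ => h _ _ _

/-- The submodule `⨁ i, P i ⊗ W i` of `V` given by subspaces of the multiplicity spaces. -/
def sub (P : ∀ i, Submodule ℂ (Fin (n i) → ℂ)) : LieSubmodule ℂ 𝔤 V where
  toSubmodule := Submodule.span ℂ {v | ∃ i, ∃ p ∈ P i, ∃ x, D.toHom i p x = v}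
  lie_mem := by
    intro g v hv
    change v ∈ Submodule.span ℂ _ at hv
    change ⁅g, v⁆ ∈ Submodule.span ℂ _
    induction hv using Submodule.span_induction with
    | mem v hv =>
      obtain ⟨i, p, hp, x, rfl⟩ := hv
      rw [← LieModuleHom.map_lie]
      exact Submodule.subset_span ⟨i, p, hp, _, rfl⟩
    | zero => simp
    | add a b _ _ ha hb =>
      rw [lie_add]
      exact add_mem ha hb
    | smul c a _ ha =>
      rw [lie_smul]
      exact Submodule.smul_mem _ c ha

variable {D} {P Q : ∀ i, Submodule ℂ (Fin (n i) → ℂ)}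

lemma toHom_mem_sub {i : Fin k} {p : Fin (n i) → ℂ} (hp : p ∈ P i) (x : W i) :
    D.toHom i p x ∈ D.sub P :=
  Submodule.subset_span ⟨i, p, hp, x, rfl⟩

lemma sub_le_iff {N : Submodule ℂ V} :
    (D.sub P).toSubmodule ≤ N ↔ ∀ i, ∀ p ∈ P i, ∀ x, D.toHom i p x ∈ N := by
  refine ⟨fun h i p hp x => h (toHom_mem_sub hp x), fun h => Submodule.span_le.2 ?_⟩
  rintro _ ⟨i, p, hp, x, rfl⟩
  exact h i p hp x

lemma endo_mem_sub {T : ∀ i, (Fin (n i) → ℂ) →ₗ[ℂ] (Fin (n i) → ℂ)}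
    (h : ∀ i, ∀ p ∈ P i, T i p ∈ Q i) {v : V} (hv : v ∈ D.sub P) : D.endo T v ∈ D.sub Q := by
  have h1 : (D.sub P).toSubmodule ≤ (D.sub Q).toSubmodule.comap (D.endo T) := by
    rw [sub_le_iff]
    intro i p hp x
    rw [Submodule.mem_comap, endo_toHom]
    exact toHom_mem_sub (h i p hp) x
  exact h1 hv

lemma endo_eq_self {T : ∀ i, (Fin (n i) → ℂ) →ₗ[ℂ] (Fin (n i) → ℂ)}
    (h : ∀ i, ∀ p ∈ P i, T i p = p) {v : V} (hv : v ∈ D.sub P) : D.endo T v = v := by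
  have h1 : (D.sub P).toSubmodule ≤ LinearMap.ker (D.endo T - LinearMap.id) := by
    rw [sub_le_iff]
    intro i p hp x
    rw [LinearMap.mem_ker, LinearMap.sub_apply, endo_toHom, h i p hp]
    simp
  exact sub_eq_zero.1 (h1 hv)

lemma endo_eq_zero {T : ∀ i, (Fin (n i) → ℂ) →ₗ[ℂ] (Fin (n i) → ℂ)}
    (h : ∀ i, ∀ p ∈ P i, T i p = 0) {v : V} (hv : v ∈ D.sub P) : D.endo T v = 0 := by
  have h1 : (D.sub P).toSubmodule ≤ LinearMap.ker (D.endo T) := by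
    rw [sub_le_iff]
    intro i p hp x
    rw [LinearMap.mem_ker, endo_toHom, h i p hp]
    simp
  exact h1 hv

/-- The projections onto P_i along Q_i induce an endomorphism of V that is the identity on one
submodule and zero on the other; splitting each p accordingly shows that they span V. -/
lemma isCompl_sub (h : ∀ i, IsCompl (P i) (Q i)) :
    IsCompl (D.sub P).toSubmodule (D.sub Q).toSubmodule := by
  constructor
  · rw [Submodule.disjoint_def]
    intro v hP hQ
    have h1 := endo_eq_self (D := D) (T := fun i => (P i).projection (Q i) (h i))
      (fun i p hp => Submodule.projection_apply_of_mem_left _ hp) hP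
    have h2 := endo_eq_zero (D := D) (T := fun i => (P i).projection (Q i) (h i))
      (fun i p hp => Submodule.projection_apply_of_mem_right _ hp) hQ
    rw [← h1, h2]
  · rw [codisjoint_iff]
    refine D.eq_top_of_forall_toHom_mem fun i p x => ?_
    rw [← Submodule.projection_add_projection_eq_self (h i) p, map_add, LieModuleHom.add_apply]
    exact Submodule.add_mem_sup (toHom_mem_sub (Submodule.projection_apply_mem _ _) x)
      (toHom_mem_sub (Submodule.projection_apply_mem _ _) x)

variable (D) in
/-- The vectors whose attached morphisms have values in a given submodule. -/
def homs (N : LieSubmodule ℂ 𝔤 V) (i : Fin k) : Submodule ℂ (Fin (n i) → ℂ) where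
  carrier := {p | ∀ x, D.toHom i p x ∈ N}
  zero_mem' x := by simp
  add_mem' hp hq x := by
    rw [map_add, LieModuleHom.add_apply]
    exact add_mem (hp x) (hq x)
  smul_mem' c p hp x := by
    rw [map_smul, LieModuleHom.smul_apply]
    exact N.smul_mem c (hp x)

/-- For p in the left side, projecting along P_i to a complement induces an endomorphism killing
`D.sub P`. The morphism attached to the projected p is therefore zero, so p lies in P_i. -/
lemma homs_sub (P : ∀ i, Submodule ℂ (Fin (n i) → ℂ)) : D.homs (D.sub P) = P := by
  funext i
  refine le_antisymm (fun p hp => ?_) fun p hp x => toHom_mem_sub hp x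
  choose Q hQ using fun i => (P i).exists_isCompl
  rw [← Submodule.projection_apply_eq_zero_iff (hQ i).symm]
  apply (D.toHom i).injective
  ext x
  rw [map_zero, LieModuleHom.zero_apply,
    ← D.endo_toHom fun i => (Q i).projection (P i) (hQ i).symm]
  exact endo_eq_zero (fun i p hp => Submodule.projection_apply_of_mem_right _ hp) (hp x)

lemma sub_injective : Function.Injective D.sub := fun P Q h => by
  rw [← homs_sub (D := D) P, h, homs_sub]

lemma disjoint_of_disjoint_sub (h : Disjoint (D.sub P).toSubmodule (D.sub Q).toSubmodule)
    (i : Fin k) : Disjoint (P i) (Q i) := by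
  rw [Submodule.disjoint_def] at h ⊢
  intro p hP hQ
  apply (D.toHom i).injective
  ext x
  rw [h _ (toHom_mem_sub hP x) (toHom_mem_sub hQ x)]
  simp

/-- Isomorphisms P_i ≅ Q_i and their inverses, extended by zero on complements, induce endomorphisms
of V that restrict to mutually inverse morphisms. -/
lemma nonempty_equiv_sub (h : ∀ i, Module.finrank ℂ (P i) = Module.finrank ℂ (Q i)) :
    Nonempty (D.sub P ≃ₗ⁅ℂ,𝔤⁆ D.sub Q) := by
  choose P' hP using fun i => (P i).exists_isCompl
  choose Q' hQ using fun i => (Q i).exists_isCompl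
  let e := fun i => LinearEquiv.ofFinrankEq (P i) (Q i) (h i)
  let T := fun i => (Q i).subtype ∘ₗ (e i).toLinearMap ∘ₗ (P i).projectionOnto (P' i) (hP i)
  let T' := fun i => (P i).subtype ∘ₗ (e i).symm.toLinearMap ∘ₗ (Q i).projectionOnto (Q' i) (hQ i)
  have hT : ∀ i, ∀ p ∈ P i, T i p ∈ Q i := fun i p _ => Subtype.property _
  have hT' : ∀ i, ∀ p ∈ Q i, T' i p ∈ P i := fun i p _ => Subtype.property _
  have hc : ∀ (R R' : ∀ i, (Fin (n i) → ℂ) →ₗ[ℂ] (Fin (n i) → ℂ)) v,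
      D.endo R (D.endo R' v) = D.endo (fun i => R i ∘ₗ R' i) v := by
    intro R R' v
    have h1 : LinearMap.eqLocus (D.endo R ∘ₗ D.endo R') (D.endo fun i => R i ∘ₗ R' i) = ⊤ :=
      D.eq_top_of_forall_toHom_mem fun i p x => by
        simp [LinearMap.mem_eqLocus, endo_toHom]
    have h2 : v ∈ LinearMap.eqLocus (D.endo R ∘ₗ D.endo R') (D.endo fun i => R i ∘ₗ R' i) := by
      rw [h1]
      trivial
    exact h2
  refine ⟨{
    toFun := fun v => ⟨D.endo T v, endo_mem_sub hT v.2⟩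
    map_add' := fun a b => Subtype.ext (by simp)
    map_smul' := fun c a => Subtype.ext (by simp)
    map_lie' := fun {g a} => Subtype.ext (by simp [endo_lie])
    invFun := fun v => ⟨D.endo T' v, endo_mem_sub hT' v.2⟩
    left_inv := fun v => Subtype.ext ?_
    right_inv := fun v => Subtype.ext ?_ }⟩
  · change D.endo T' (D.endo T v) = v
    rw [hc]
    refine endo_eq_self (fun i p hp => ?_) v.2
    simp [T, T', Submodule.projectionOnto_apply_of_mem_left (hP i) hp]
  · change D.endo T (D.endo T' v) = v
    rw [hc]
    refine endo_eq_self (fun i p hp => ?_) v.2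
    simp [T, T', Submodule.projectionOnto_apply_of_mem_left (hQ i) hp]

/-- `D.homs N i` is the copy of Hom(W_i, N) inside Hom(W_i, V) ≅ ℂ^{n_i}. -/
lemma finrank_homs (N : LieSubmodule ℂ 𝔤 V) (i : Fin k) :
    Module.finrank ℂ (D.homs N i) = Module.finrank ℂ (W i →ₗ⁅ℂ,𝔤⁆ N) := by
  let F : (W i →ₗ⁅ℂ,𝔤⁆ N) →ₗ[ℂ] (W i →ₗ⁅ℂ,𝔤⁆ V) :=
    { toFun := fun f => N.incl.comp f
      map_add' := fun f g => by ext x; simp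
      map_smul' := fun c f => by ext x; simp }
  have hF : Function.Injective ((D.toHom i).symm.toLinearMap ∘ₗ F) := by
    refine (D.toHom i).symm.injective.comp fun f g h => ?_
    ext x
    exact LieModuleHom.congr_fun h x
  have hr : D.homs N i = LinearMap.range ((D.toHom i).symm.toLinearMap ∘ₗ F) := by
    ext p
    constructor
    · intro hp
      refine ⟨LieModuleHom.codRestrict N (D.toHom i p) hp, ?_⟩
      change (D.toHom i).symm _ = p
      rw [LinearEquiv.symm_apply_eq]
      rfl
    · rintro ⟨f, rfl⟩ x
      simp only [LinearMap.comp_apply, LinearEquiv.coe_coe, LinearEquiv.apply_symm_apply]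
      exact (f x).2
  rw [hr, LinearMap.finrank_range_of_inj hF]

/-- N is the sum of the images of morphisms W_i → N, and each of them is attached to a vector of
`D.homs N i`. -/
lemma sub_homs_of_surjective {s : Fin k → ℕ} {N : LieSubmodule ℂ 𝔤 V}
    {m : ∀ i, Fin (s i) → (W i →ₗ⁅ℂ,𝔤⁆ N)} (hm : Function.Surjective (homSum m)) :
    D.sub (D.homs N) = N := by
  rw [← LieSubmodule.toSubmodule_inj]
  refine le_antisymm (sub_le_iff.2 fun i p hp x => hp x) fun v hv => ?_
  obtain ⟨x, hx⟩ := hm ⟨v, hv⟩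
  have h1 : v = ∑ i, ∑ j, (m i j (x i j) : V) := by
    have h2 := congrArg (N.toSubmodule.subtype) hx
    rw [homSum_apply, map_sum] at h2
    simp only [map_sum] at h2
    exact h2.symm
  rw [h1]
  refine sum_mem fun i _ => sum_mem fun j _ => ?_
  have h3 : (m i j (x i j) : V) = D.toHom i ((D.toHom i).symm (N.incl.comp (m i j))) (x i j) := by
    rw [LinearEquiv.apply_symm_apply]
    rfl
  rw [h3]
  refine toHom_mem_sub (fun y => ?_) _
  rw [LinearEquiv.apply_symm_apply]
  exact (m i j y).2

end IsotypicDecomposition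

end Isotypic

/-! ### Charts of the Lie Grassmannian -/

namespace IsotypicDecomposition

variable {𝔤 : Type u} [LieRing 𝔤] [LieAlgebra ℂ 𝔤] {V : Type w} [AddCommGroup V] [Module ℂ V]
  [LieRingModule 𝔤 V] [LieModule ℂ 𝔤 V]
  {k : ℕ} {W : Fin k → Type*} [∀ i, AddCommGroup (W i)]
  [∀ i, Module ℂ (W i)] [∀ i, LieRingModule 𝔤 (W i)] [∀ i, LieModule ℂ 𝔤 (W i)]
  {n s : Fin k → ℕ} (D : IsotypicDecomposition 𝔤 V W n)

section Graph

variable {P Q : ∀ i, Submodule ℂ (Fin (n i) → ℂ)} (h : ∀ i, IsCompl (P i) (Q i))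

/-- Linear maps between complementary subspaces of the multiplicity spaces induce a linear map
between the corresponding submodules. -/
def subHom : (∀ i, P i →ₗ[ℂ] Q i) →ₗ[ℂ]
    ((D.sub P).toSubmodule →ₗ[ℂ] (D.sub Q).toSubmodule) where
  toFun f := (D.endo fun i => (Q i).subtype ∘ₗ f i ∘ₗ (P i).projectionOnto (Q i) (h i)).restrict
    fun _ hv => endo_mem_sub (fun _ _ _ => Subtype.property _) hv
  map_add' f g := by
    ext v
    have h1 : (fun i => (Q i).subtype ∘ₗ (f + g) i ∘ₗ (P i).projectionOnto (Q i) (h i)) =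
        (fun i => (Q i).subtype ∘ₗ f i ∘ₗ (P i).projectionOnto (Q i) (h i)) +
        fun i => (Q i).subtype ∘ₗ g i ∘ₗ (P i).projectionOnto (Q i) (h i) := by
      funext i
      ext
      simp
    change D.endo _ v.1 = D.endo _ v.1 + D.endo _ v.1
    rw [h1, map_add]
    rfl
  map_smul' c f := by
    ext v
    have h1 : (fun i => (Q i).subtype ∘ₗ (c • f) i ∘ₗ (P i).projectionOnto (Q i) (h i)) =
        c • fun i => (Q i).subtype ∘ₗ f i ∘ₗ (P i).projectionOnto (Q i) (h i) := by
      funext i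
      ext
      simp
    change D.endo _ v.1 = c • D.endo _ v.1
    rw [h1, map_smul]
    rfl

lemma subHom_toHom (f : ∀ i, P i →ₗ[ℂ] Q i) {i : Fin k} (p : P i) (x : W i) :
    (D.subHom h f ⟨D.toHom i p x, toHom_mem_sub p.2 x⟩ : V) = D.toHom i (f i p) x := by
  change D.endo _ (D.toHom i p x) = _
  rw [endo_toHom]
  simp

variable [FiniteDimensional ℂ V]

/-- On generators p ⊗ x + f_i(p) ⊗ x lies in the big graph, which gives one inclusion; both sides
have the dimension of `D.sub P`. -/
lemma sub_graph {d : ℕ} (hP : ∀ i, Module.finrank ℂ (P i) = s i)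
    (hd : Module.finrank ℂ (D.sub P).toSubmodule = d) (f : ∀ i, P i →ₗ[ℂ] Q i) :
    (D.sub fun i => (graphGr (h i) (hP i) (f i)).1).toSubmodule =
      (graphGr (isCompl_sub (D := D) h) hd (D.subHom h f)).1 := by
  refine Submodule.eq_of_le_of_finrank_eq ?_ ?_
  · rw [sub_le_iff]
    rintro i _ ⟨p, rfl⟩ x
    refine ⟨⟨D.toHom i p x, toHom_mem_sub p.2 x⟩, ?_⟩
    rw [graphMap_apply, subHom_toHom, graphMap_apply, map_add, LieModuleHom.add_apply]
  · obtain ⟨e⟩ := nonempty_equiv_sub (D := D) (P := fun i => (graphGr (h i) (hP i) (f i)).1)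
      (Q := P) fun i => (graphGr (h i) (hP i) (f i)).2.trans (hP i).symm
    rw [(graphGr _ hd _).2, ← hd]
    exact e.toLinearEquiv.finrank_eq

end Graph

variable {D} {S : LieSubmodule ℂ 𝔤 V}
  (hS : ∀ N : LieSubmodule ℂ 𝔤 V, Nonempty (N ≃ₗ⁅ℂ,𝔤⁆ S) →
    D.sub (D.homs N) = N ∧ ∀ i, Module.finrank ℂ (D.homs N i) = s i)

include hS

/-- The hypothesis `hS` is all the representation theory needed from here on: every copy of S in V
is recovered from its multiplicity spaces, and these have dimensions s_i. -/
lemma nonempty_sub_equiv {P : ∀ i, Submodule ℂ (Fin (n i) → ℂ)}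
    (hP : ∀ i, Module.finrank ℂ (P i) = s i) : Nonempty (D.sub P ≃ₗ⁅ℂ,𝔤⁆ S) := by
  obtain ⟨h1, h2⟩ := hS S ⟨LieModuleEquiv.refl⟩
  obtain ⟨e⟩ := nonempty_equiv_sub (D := D) (P := P) (Q := D.homs S)
    fun i => (hP i).trans (h2 i).symm
  rw [h1] at e
  exact ⟨e⟩

lemma finrank_sub {P : ∀ i, Submodule ℂ (Fin (n i) → ℂ)}
    (hP : ∀ i, Module.finrank ℂ (P i) = s i) :
    Module.finrank ℂ (D.sub P).toSubmodule = Module.finrank ℂ S := by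
  obtain ⟨e⟩ := nonempty_sub_equiv hS hP
  exact e.toLinearEquiv.finrank_eq

/-- The bijection between families of subspaces of the multiplicity spaces and submodules
isomorphic to `S`. -/
def grEquiv : (∀ i, Gr (Fin (n i) → ℂ) (s i)) ≃ lieGrSet S := by
  refine Equiv.ofBijective (fun P => ⟨⟨(D.sub fun i => (P i).1).toSubmodule,
    finrank_sub hS fun i => (P i).2⟩, _, rfl, nonempty_sub_equiv hS fun i => (P i).2⟩) ⟨?_, ?_⟩
  · intro P P' h
    have h1 : D.sub (fun i => (P i).1) = D.sub fun i => (P' i).1 :=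
      LieSubmodule.toSubmodule_injective (congrArg (fun U : lieGrSet S => U.1.1) h)
    funext i
    exact Subtype.ext (congrFun (sub_injective h1) i)
  · rintro ⟨U, N, hNU, hN⟩
    obtain ⟨h1, h2⟩ := hS N hN
    refine ⟨fun i => ⟨D.homs N i, h2 i⟩, Subtype.ext (Subtype.ext ?_)⟩
    exact (congrArg LieSubmodule.toSubmodule h1).trans hNU

lemma coe_grEquiv (P : ∀ i, Gr (Fin (n i) → ℂ) (s i)) :
    (grEquiv hS P).1.1 = (D.sub fun i => (P i).1).toSubmodule := rfl

variable [FiniteDimensional ℂ V] {P Q : ∀ i, Submodule ℂ (Fin (n i) → ℂ)}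
  (h : ∀ i, IsCompl (P i) (Q i)) (hP : ∀ i, Module.finrank ℂ (P i) = s i)

lemma grEquiv_graph (f : ∀ i, P i →ₗ[ℂ] Q i) :
    (grEquiv hS fun i => graphGr (h i) (hP i) (f i)).1 =
      graphGr (isCompl_sub (D := D) h) (finrank_sub hS hP) (D.subHom h f) :=
  Subtype.ext (sub_graph D h hP _ f)

include hP in
lemma subHom_injective : Function.Injective (D.subHom h) := by
  intro f g hfg
  have h1 : grEquiv hS (fun i => graphGr (h i) (hP i) (f i)) =
      grEquiv hS fun i => graphGr (h i) (hP i) (g i) := by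
    apply Subtype.ext
    rw [grEquiv_graph, grEquiv_graph, hfg]
  funext i
  exact graphGr_injective (h i) (hP i) (congrFun ((grEquiv hS).injective h1) i)

/-- The chart condition is disjointness from ⨁ Q_i ⊗ W_i, which forces each multiplicity space of U
to be disjoint from Q_i and hence to be a graph. -/
lemma exists_of_mem_range_graphGr {U : lieGrSet S}
    (hU : U.1 ∈ Set.range (graphGr (isCompl_sub (D := D) h) (finrank_sub hS hP))) :
    ∃ f : ∀ i, P i →ₗ[ℂ] Q i, grEquiv hS (fun i => graphGr (h i) (hP i) (f i)) = U := by
  obtain ⟨R, rfl⟩ := (grEquiv hS).surjective U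
  rw [range_graphGr, Set.mem_ofPred_eq, coe_grEquiv] at hU
  have hR : ∀ i, R i ∈ Set.range (graphGr (h i) (hP i)) := fun i => by
    rw [range_graphGr]
    exact disjoint_of_disjoint_sub hU i
  choose f hf using hR
  exact ⟨f, by rw [show (fun i => graphGr (h i) (hP i) (f i)) = R from funext hf]⟩

/-- Affine charts of the Lie Grassmannian. -/
lemma isChart_grEquiv : FunSpace.IsChart (lieGrassmannian S) (affineSpace (∀ i, P i →ₗ[ℂ] Q i))
    (fun f => grEquiv hS fun i => graphGr (h i) (hP i) (f i)) := by
  have hc := isChart_graphGr (isCompl_sub (D := D) h) (finrank_sub hS hP)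
  refine ⟨fun f g hfg => funext fun i => graphGr_injective (h i) (hP i)
    (congrFun ((grEquiv hS).injective hfg) i), ⟨_, hc.isOpen_range, ?_⟩, ?_⟩
  · ext U
    constructor
    · intro hU
      exact exists_of_mem_range_graphGr hS h hP hU
    · rintro ⟨f, rfl⟩
      exact ⟨D.subHom h f, (grEquiv_graph hS h hP f).symm⟩
  · change FunSpace.induced (FunSpace.induced _ _) _ = _
    rw [FunSpace.induced_induced]
    have h1 : (Subtype.val ∘ fun f : ∀ i, P i →ₗ[ℂ] Q i =>
        grEquiv hS fun i => graphGr (h i) (hP i) (f i)) =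
        graphGr (isCompl_sub (D := D) h) (finrank_sub hS hP) ∘ D.subHom h :=
      funext (grEquiv_graph hS h hP)
    -- The structure is induced from the affine chart of the large Grassmannian along the injective
    -- linear map `subHom`.
    rw [h1, ← FunSpace.induced_induced, hc.induced_eq]
    exact induced_affineSpace (E := ∀ i, P i →ₗ[ℂ] Q i)
      (F := (D.sub P).toSubmodule →ₗ[ℂ] (D.sub Q).toSubmodule) (subHom_injective hS h hP)

/-- Around each of its points there is a chart in which the set is the range of the linear map
`subHom`, hence closed there. -/
lemma isLocallyClosed_lieGrSet :
    @IsLocallyClosed _ (grassmannian V (Module.finrank ℂ S)).topology (lieGrSet S) := by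
  let _ := (grassmannian V (Module.finrank ℂ S)).topology
  refine ((isLocallyClosed_tfae (lieGrSet S)).out 0 3).2 fun U hU => ?_
  obtain ⟨R, hR⟩ := (grEquiv hS).surjective ⟨U, hU⟩
  choose Q h using fun i => (R i).1.exists_isCompl
  have hP : ∀ i, Module.finrank ℂ (R i).1 = s i := fun i => (R i).2
  have hc := isChart_graphGr (isCompl_sub (D := D) h) (finrank_sub hS hP)
  let _ := (affineSpace ((D.sub fun i => (R i).1).toSubmodule →ₗ[ℂ] (D.sub Q).toSubmodule)).topology
  have ho := hc.isOpenEmbedding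
  have hpre : graphGr (isCompl_sub (D := D) h) (finrank_sub hS hP) ⁻¹' lieGrSet S =
      Set.range (D.subHom h) := by
    ext F
    constructor
    · intro hF
      obtain ⟨f, hf⟩ := exists_of_mem_range_graphGr hS h hP (U := ⟨_, hF⟩) ⟨F, rfl⟩
      have h1 := congrArg Subtype.val hf
      rw [grEquiv_graph] at h1
      exact ⟨f, graphGr_injective _ _ h1⟩
    · rintro ⟨f, rfl⟩
      rw [Set.mem_preimage, ← grEquiv_graph hS h hP f]
      exact Subtype.property _
  refine ⟨Set.range (graphGr (isCompl_sub (D := D) h) (finrank_sub hS hP)), ?_, hc.isOpen_range, ?_⟩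
  · rw [range_graphGr, Set.mem_ofPred_eq]
    have h2 : U.1 = (D.sub fun i => (R i).1).toSubmodule := by
      rw [← coe_grEquiv hS R, hR]
    rw [h2]
    exact (isCompl_sub h).disjoint
  · rintro _ ⟨⟨F, rfl⟩, hF⟩
    have h3 : F ∈ closure
        (graphGr (isCompl_sub (D := D) h) (finrank_sub hS hP) ⁻¹' lieGrSet S) := by
      rw [← ho.isOpenMap.preimage_closure_eq_closure_preimage ho.continuous]
      exact hF
    rw [hpre, (isClosed_range_affineSpace (D.subHom h)).closure_eq, ← hpre] at h3
    exact h3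

end IsotypicDecomposition

/-! ### Geometry of the Lie Grassmannian -/

namespace IsotypicDecomposition

variable {𝔤 : Type u} [LieRing 𝔤] [LieAlgebra ℂ 𝔤] {V : Type w} [AddCommGroup V] [Module ℂ V]
  [LieRingModule 𝔤 V] [LieModule ℂ 𝔤 V]
  {k : ℕ} {W : Fin k → Type*} [∀ i, AddCommGroup (W i)]
  [∀ i, Module ℂ (W i)] [∀ i, LieRingModule 𝔤 (W i)] [∀ i, LieModule ℂ 𝔤 (W i)]
  {n s : Fin k → ℕ} {D : IsotypicDecomposition 𝔤 V W n} {S : LieSubmodule ℂ 𝔤 V}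
  (hS : ∀ N : LieSubmodule ℂ 𝔤 V, Nonempty (N ≃ₗ⁅ℂ,𝔤⁆ S) →
    D.sub (D.homs N) = N ∧ ∀ i, Module.finrank ℂ (D.homs N i) = s i)

/-- Every complement of a family of subspaces defines an affine chart containing the point. -/
lemma mem_range_chart (R : ∀ i, Gr (Fin (n i) → ℂ) (s i))
    {P Q : ∀ i, Submodule ℂ (Fin (n i) → ℂ)} (h : ∀ i, IsCompl (P i) (Q i))
    (hP : ∀ i, Module.finrank ℂ (P i) = s i) (hR : ∀ i, IsCompl (R i).1 (Q i)) :
    grEquiv hS R ∈ Set.range fun f : ∀ i, P i →ₗ[ℂ] Q i =>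
      grEquiv hS fun i => graphGr (h i) (hP i) (f i) := by
  have h1 : ∀ i, R i ∈ Set.range (graphGr (h i) (hP i)) := fun i => by
    rw [range_graphGr]
    exact (hR i).disjoint
  choose f hf using h1
  exact ⟨f, congrArg (grEquiv hS) (funext hf)⟩

variable [FiniteDimensional ℂ V]

include hS

/-- The affine space ∏ Hom(P_i, Q_i) is a chart of both sides, and `grEquiv` matches the two
parametrizations. -/
lemma isomorphic_prod_grassmannian : (lieGrassmannian S).Isomorphic
    (FunSpace.prod fun i => grassmannian (Fin (n i) → ℂ) (s i)) := by
  refine FunSpace.isomorphic_of_charts (grEquiv hS).symm fun U => ?_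
  obtain ⟨R, rfl⟩ := (grEquiv hS).surjective U
  choose Q h using fun i => (R i).1.exists_isCompl
  have hP : ∀ i, Module.finrank ℂ (R i).1 = s i := fun i => (R i).2
  refine ⟨_, _, _, isChart_grEquiv hS h hP, ?_, mem_range_chart hS R h hP h⟩
  simp only [Equiv.symm_apply_apply]
  exact isChart_pi fun i => isChart_graphGr (h i) (hP i)

lemma smooth_lieGrassmannian : (lieGrassmannian S).Smooth := by
  refine FunSpace.smooth_of_charts fun U => ?_
  obtain ⟨R, rfl⟩ := (grEquiv hS).surjective U
  choose Q h using fun i => (R i).1.exists_isCompl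
  have hP : ∀ i, Module.finrank ℂ (R i).1 = s i := fun i => (R i).2
  exact ⟨_, _, _, isChart_grEquiv hS h hP, smooth_affineSpace _, mem_range_chart hS R h hP h⟩

lemma dim_lieGrassmannian :
    (lieGrassmannian S).dim = ((∑ i, (n i - s i) * s i : ℕ) : WithBot ℕ∞) := by
  have : Nonempty (lieGrSet S) := ⟨⟨⟨S.toSubmodule, rfl⟩, S, rfl, ⟨LieModuleEquiv.refl⟩⟩⟩
  refine FunSpace.dim_of_charts fun U => ?_
  obtain ⟨R, rfl⟩ := (grEquiv hS).surjective U
  choose Q h using fun i => (R i).1.exists_isCompl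
  have hP : ∀ i, Module.finrank ℂ (R i).1 = s i := fun i => (R i).2
  have hdim : Module.finrank ℂ (∀ i, (R i).1 →ₗ[ℂ] Q i) = ∑ i, (n i - s i) * s i := by
    rw [Module.finrank_pi_fintype]
    refine Finset.sum_congr rfl fun i _ => ?_
    have h1 := Submodule.finrank_add_eq_of_isCompl (h i)
    rw [hP i, Module.finrank_fin_fun] at h1
    rw [Module.finrank_linearMap, hP i, mul_comm, Nat.eq_sub_of_add_eq' h1]
  exact ⟨_, _, _, isChart_grEquiv hS h hP, by rw [dim_affineSpace, hdim],
    mem_range_chart hS R h hP h⟩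

/-- A common complement of the multiplicity spaces of two points gives a chart, irreducible as an
affine space, that contains both. -/
lemma irreducible_lieGrassmannian : (lieGrassmannian S).Irreducible := by
  have : Nonempty (lieGrSet S) := ⟨⟨⟨S.toSubmodule, rfl⟩, S, rfl, ⟨LieModuleEquiv.refl⟩⟩⟩
  refine FunSpace.irreducible_of_charts fun U => ?_
  obtain ⟨R, rfl⟩ := (grEquiv hS).surjective U
  choose Q h using fun i => (R i).1.exists_isCompl
  have hP : ∀ i, Module.finrank ℂ (R i).1 = s i := fun i => (R i).2
  refine ⟨_, _, _, isChart_grEquiv hS h hP, irreducible_affineSpace _,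
    mem_range_chart hS R h hP h, fun U' => ?_⟩
  obtain ⟨R', rfl⟩ := (grEquiv hS).surjective U'
  choose Q' h1 h2 using fun i => Submodule.exists_common_isCompl
    (P := (R i).1) (Q := (R' i).1) ((R i).2.trans (R' i).2.symm)
  have hc := isChart_grEquiv hS h1 hP
  refine ⟨_, hc.isOpen_range, mem_range_chart hS R' h1 hP h2, ?_,
    ⟨_, mem_range_chart hS R h1 hP h1, mem_range_chart hS R h hP h⟩⟩
  let _ := (lieGrassmannian S).topology
  let _ := (affineSpace (∀ i, (R i).1 →ₗ[ℂ] Q' i)).topology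
  have : IrreducibleSpace (∀ i, (R i).1 →ₗ[ℂ] Q' i) := irreducible_affineSpace _
  rw [← Set.image_univ]
  exact (IrreducibleSpace.isIrreducible_univ _).2.image _
    hc.isOpenEmbedding.continuous.continuousOn

end IsotypicDecomposition

theorem proposition31 {𝔤 : Type u} [LieRing 𝔤] [LieAlgebra ℂ 𝔤] [FiniteDimensional ℂ 𝔤]
    [LieAlgebra.IsSemisimple ℂ 𝔤]
    {V : Type w} [AddCommGroup V] [Module ℂ V] [LieRingModule 𝔤 V] [LieModule ℂ 𝔤 V]
    [FiniteDimensional ℂ V] (S : LieSubmodule ℂ 𝔤 V)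
    (k : ℕ) (W : Fin k → Type w) [∀ i, AddCommGroup (W i)] [∀ i, Module ℂ (W i)]
    [∀ i, LieRingModule 𝔤 (W i)] [∀ i, LieModule ℂ 𝔤 (W i)] [∀ i, FiniteDimensional ℂ (W i)]
    (hirr : ∀ i, LieModule.IsIrreducible ℂ 𝔤 (W i))
    (hdist : ∀ i j, i ≠ j → IsEmpty (W i ≃ₗ⁅ℂ,𝔤⁆ W j))
    (n s : Fin k → ℕ)
    (hV : cl 𝔤 V = ∑ i, n i • cl 𝔤 (W i))
    (hS : cl 𝔤 S = ∑ i, s i • cl 𝔤 (W i)) :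
    (∀ i, s i ≤ n i) ∧
    @IsLocallyClosed _ (grassmannian V (Module.finrank ℂ S)).topology (lieGrSet S) ∧
    (lieGrassmannian S).Isomorphic
      (FunSpace.prod fun i => grassmannian (Fin (n i) → ℂ) (s i)) ∧
    (lieGrassmannian S).Irreducible ∧
    (lieGrassmannian S).Smooth ∧
    (lieGrassmannian S).dim = ((∑ i, (n i - s i) * s i : ℕ) : WithBot ℕ∞) := by
  obtain ⟨D⟩ := nonempty_isotypicDecomposition hirr hdist hV
  have h : ∀ N : LieSubmodule ℂ 𝔤 V, Nonempty (N ≃ₗ⁅ℂ,𝔤⁆ S) →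
      D.sub (D.homs N) = N ∧ ∀ i, Module.finrank ℂ (D.homs N i) = s i := by
    rintro N ⟨e⟩
    -- N has the class of S, so bases of the spaces Hom(W_i, N) have s_i elements and their images
    -- span N.
    have hN : cl 𝔤 N = ∑ i, s i • cl 𝔤 (W i) := (cl_congr e).trans hS
    have hf := finrank_hom_irreducible_of_cl_eq hirr hdist hN
    refine ⟨D.sub_homs_of_surjective (homSum_bijective_of_cl_eq hirr hdist hN
      (m := fun i => Module.finBasisOfFinrankEq ℂ _ (hf i))
      fun i => Module.Basis.linearIndependent _).2, fun i => ?_⟩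
    rw [IsotypicDecomposition.finrank_homs, hf]
  refine ⟨fun i => ?_, IsotypicDecomposition.isLocallyClosed_lieGrSet h,
    IsotypicDecomposition.isomorphic_prod_grassmannian h,
    IsotypicDecomposition.irreducible_lieGrassmannian h,
    IsotypicDecomposition.smooth_lieGrassmannian h,
    IsotypicDecomposition.dim_lieGrassmannian h⟩
  -- The multiplicity spaces of S itself are subspaces of ℂ^{n_i} of dimension s_i.
  rw [← (h S ⟨LieModuleEquiv.refl⟩).2 i]
  exact (Submodule.finrank_le _).trans_eq (Module.finrank_fin_fun ℂ)

end
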